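/- **Theorem (Sub-additivity of op-dimension).** Let $\mathcal L$ be a first-order language, let $\kappa$ be an uncountable cardinal, and let $\mathbb U$ be a $\kappa$-saturated $\mathcal L$-structure (a monster model of its complete theory). Let $a$ and $b$ be finite tuples from $\mathbb U$ and let $A\subseteq\mathbb U$ with $|A|<\kappa$. Then $$\mathrm{opD}(a,b/A)\;\le\;\mathrm{opD}(a/A)+\mathrm{opD}(b/A\cup\{a\}),$$ and likewise $$\mathrm{irdD}(a,b/A)\;\le\;\mathrm{irdD}(a/A)+\mathrm{irdD}(b/A\cup\{a\}).$$ Here $A\cup\{a\}$ is $A$ together with the entries of $a$, and $\mathrm{opD}(c/B)=\mathrm{opD}(\mathrm{tp}(c/B))$, $\mathrm{irdD}(c/B)=\mathrm{irdD}(\mathrm{tp}(c/B))$. For a consistent partial type $\pi(x)$ in finitely many variables with parameters from $\mathbb U$ (consistent: finitely satisfiable in $\mathbb U$) the two dimensions are as follows, with values in $\{0,1,2,\dots\}\cup\{\omega\}$ and $\sup\emptyset=0$. Formulas have parameters from $\mathbb U$, and $\varphi^1=\varphi$, $\varphi^0=\neg\varphi$. * *Op-dimension through op-ranks.* For $0<n<\omega$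 and a finite set $\Delta$ of partitioned formulas $\varphi(x,y)$ ($y$ a finite tuple that may vary with $\varphi$): $\mathrm{opR}_n(\pi,\Delta)\ge 0$ for every consistent $\pi$; for a limit ordinal $\lambda$, $\mathrm{opR}_n(\pi,\Delta)\ge\lambda$ iff $\mathrm{opR}_n(\pi,\Delta)\ge\alpha$ for all $\alpha<\lambda$; and $\mathrm{opR}_n(\pi,\Delta)\ge\alpha+1$ iff there are instances $\varphi_0(x,c_0),\dots,\varphi_{n-1}(x,c_{n-1})$ of formulas of $\Delta$ such that for every $\sigma\in 2^n$ the partial type $\pi(x)\cup\{\bigwedge_{i<n}\varphi_i(x,c_i)^{\sigma(i)}\}$ is consistent and has $\mathrm{opR}_n(\,\cdot\,,\Delta)\ge\alpha$. One writes $\mathrm{opR}_n(\pi,\Delta)=\infty$ if $\mathrm{opR}_n(\pi,\Delta)\ge\alpha$ for every ordinal $\alpha$, and $$\mathrm{opD}(\pi)=\sup\{0<n<\omega:\ \mathrm{opR}_n(\pi,\Delta)=\infty\text{ for some finite }\Delta\}.$$ * *Op-dimension through IRD-patterns.* An IRD-pattern in $\pi$ of depth $n$ and length $\omega$ consists of formulas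 $\psi_i(x,y_i)$ ($i<n$) and tuples $b_{j,i}$ from $\mathbb U$ ($j<\omega$, $i<n$) such that for every $f:n\to\omega$ the set $$\pi(x)\cup\{\neg\psi_i(x,b_{j,i}): i<n,\ j<f(i)\}\cup\{\psi_i(x,b_{j,i}): i<n,\ f(i)\le j<\omega\}$$ is consistent; $\mathrm{irdD}(\pi)$ is the supremum of the $n<\omega$ for which such a pattern exists. -/

import Mathlib

open FirstOrder Cardinal Set

universe u v w x

namespace OpDimension

open FirstOrder.Language

section

variable (L : FirstOrder.Language.{u, v}) (U : Type w)

/-- A partial type in the variables `α` with parameters from `U`: a set of `L(U)`-formulas. -/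
abbrev PartialType (α : Type x) : Type (max u v w x) := Set (L[[U]].Formula α)

/-- A partitioned `L(U)`-formula `φ(x, y)`: `x` is indexed by `α`, and `y` is a finite tuple
of variables, of length `φ.1`. -/
abbrev PartitionedFormula (α : Type x) : Type (max u v w x) :=
  Σ k : ℕ, L[[U]].Formula (α ⊕ Fin k)

end

section

variable {L : FirstOrder.Language.{u, v}} {U : Type w} {α : Type x}

/-- The instance `φ(x, c)` of a partitioned formula `φ(x, y)` at a tuple `c` from `U`. -/
def PartitionedFormula.inst (φ : PartitionedFormula L U α) (c : Fin φ.1 → U) :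
    L[[U]].Formula α :=
  BoundedFormula.subst φ.2
    (Sum.elim (fun i => Term.var i) (fun j => Constants.term (L.con (c j))))

/-- The convention `φ¹ = φ`, `φ⁰ = ¬ φ`. -/
def signed (φ : L[[U]].Formula α) (t : Bool) : L[[U]].Formula α :=
  if t then φ else φ.not

variable [L.Structure U]

theorem PartitionedFormula.realize_inst (φ : PartitionedFormula L U α) (c : Fin φ.1 → U)
    (a : α → U) : (φ.inst c).Realize a ↔ φ.2.Realize (Sum.elim a c) := by
  unfold PartitionedFormula.inst Formula.Realize
  rw [BoundedFormula.realize_subst]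
  apply iff_of_eq
  congr 1
  funext i
  rcases i with i | j
  · simp
  · simp only [Sum.elim_inr, Term.realize_constants]
    rfl

theorem realize_signed (φ : L[[U]].Formula α) (t : Bool) (a : α → U) :
    (signed φ t).Realize a ↔ (φ.Realize a ↔ t = true) := by
  cases t <;> simp [signed]

/-- Consistency of a partial type with the elementary diagram of `U`, i.e. finite
satisfiability in `U`. -/
def Consistent (π : PartialType L U α) : Prop :=
  ∀ s : Finset (L[[U]].Formula α), (s : Set (L[[U]].Formula α)) ⊆ π →
    ∃ a : α → U, ∀ φ ∈ s, φ.Realize a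

/-- The set of `L(U)`-formulas whose parameters lie in `A`. -/
def formulasOver (L : FirstOrder.Language.{u, v}) {U : Type w} (α : Type x) (A : Set U) :
    Set (L[[U]].Formula α) :=
  Set.range (fun ψ : L[[A]].Formula α =>
    (L.lhomWithConstantsMap (Subtype.val : A → U)).onFormula ψ)

/-- The complete type `tp(a/A)`. -/
def tp (L : FirstOrder.Language.{u, v}) {U : Type w} [L.Structure U] {α : Type x}
    (a : α → U) (A : Set U) : PartialType L U α :=
  {φ | φ ∈ formulasOver L α A ∧ φ.Realize a}

/-- `U` is `κ`-saturated: every consistent partial type in one variable over fewer than `κ`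
parameters is realized in `U`. -/
def IsSaturated (L : FirstOrder.Language.{u, v}) (U : Type w) [L.Structure U]
    (κ : Cardinal.{w}) : Prop :=
  ∀ A : Set U, #A < κ → ∀ π : PartialType L U (Fin 1), π ⊆ formulasOver L (Fin 1) A →
    Consistent π → ∃ a : Fin 1 → U, ∀ φ ∈ π, φ.Realize a

/-- `OpRankGE n Δ γ π` says `opR_n(π, Δ) ≥ γ`. Only consistent partial types have a rank, so
the clause for `0` asks for consistency. -/
inductive OpRankGE (n : ℕ) (Δ : Finset (PartitionedFormula L U α)) :
    Ordinal.{w} → PartialType L U α → Prop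
  | zero (π : PartialType L U α) (h : Consistent π) : OpRankGE n Δ 0 π
  | limit (γ : Ordinal.{w}) (π : PartialType L U α) (hγ : Order.IsSuccLimit γ)
      (h : ∀ δ < γ, OpRankGE n Δ δ π) : OpRankGE n Δ γ π
  | succ (γ : Ordinal.{w}) (π : PartialType L U α) (φ : Fin n → PartitionedFormula L U α)
      (hφ : ∀ i, φ i ∈ Δ) (c : ∀ i, Fin (φ i).1 → U)
      (h : ∀ σ : Fin n → Bool, OpRankGE n Δ γ
        (π ∪ {Formula.iInf (fun i => signed ((φ i).inst (c i)) (σ i))})) :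
      OpRankGE n Δ (Order.succ γ) π

/-- `opR_n(π, Δ) = ∞`. Ordinals in the universe of `U` suffice, since the rank only
involves the instances of the finite set `Δ`. -/
def OpRankInfinite (n : ℕ) (Δ : Finset (PartitionedFormula L U α))
    (π : PartialType L U α) : Prop :=
  ∀ γ : Ordinal.{w}, OpRankGE n Δ γ π

/-- The op-dimension `opD(π) = sup {0 < n < ω : ∃ Δ, opR_n(π, Δ) = ∞}`; the value `⊤`
stands for `ω`. -/
noncomputable def opDim (π : PartialType L U α) : ℕ∞ :=
  sSup ((fun n : ℕ => (n : ℕ∞)) '' {n : ℕ | 0 < n ∧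
    ∃ Δ : Finset (PartitionedFormula L U α), OpRankInfinite n Δ π})

/-- `ψ` and `b` form an IRD-pattern in `π`, of depth `n` and length `ω`. -/
def IsIRDPattern (π : PartialType L U α) {n : ℕ} (ψ : Fin n → PartitionedFormula L U α)
    (b : ∀ i : Fin n, ℕ → Fin (ψ i).1 → U) : Prop :=
  ∀ f : Fin n → ℕ, Consistent (π
    ∪ {θ | ∃ i j, j < f i ∧ θ = ((ψ i).inst (b i j)).not}
    ∪ {θ | ∃ i j, f i ≤ j ∧ θ = (ψ i).inst (b i j)})

/-- The supremum of the depths of IRD-patterns of length `ω` in `π`; the value `⊤`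
stands for `ω`. -/
noncomputable def irdDim (π : PartialType L U α) : ℕ∞ :=
  sSup ((fun n : ℕ => (n : ℕ∞)) '' {n : ℕ |
    ∃ (ψ : Fin n → PartitionedFormula L U α) (b : ∀ i : Fin n, ℕ → Fin (ψ i).1 → U),
      IsIRDPattern π ψ b})

end

end OpDimension

namespace OpDimension

open FirstOrder.Language

/-! ### Ramsey's theorem for increasing tuples of natural numbers. -/

section Ramsey

/-! Depth of IRD-patterns. Take a pattern of depth `n` in `tp(ab/A)` and pool its parameters into
one sequence of rows. By Ramsey and saturation the rows become a sequence `R` indexed by ℚ,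
indiscernible over `A`, such that `ab` itself cuts it `n` times: `D i` fails on the block [2i, 2i+1)
and holds on [2i+1, 2i+2). A second extraction makes the blocks mutually indiscernible over `A ∪
range a` and keeps the rest (`exists_indisc_cuts`, `exists_blockIndisc_cuts`).

Now ask, for each `i`, whether truth over `A ∪ range a` survives moving one row from block 2i to
block 2i+1 (`MergeStep`). Where it does, `a` does not see the cut, which can be slid along block 2i
over `A ∪ range a`: these `i` give a pattern for `b` over `A ∪ range a`
(`card_mem_irdDepths_of_mergeStep`). Where it does not, some formula over `A`, evaluated at `a` and
with auxiliary rows as parameters, detects the cut. As `R` is indiscernible over `A`, that cut can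
be slid too: these `i` give a pattern for `a` over `A` (`card_mem_irdDepths_of_not_mergeStep`).
Every `i` is counted exactly once, so `n = n₁ + n₂`.

Op-dimension. For the type of a finite tuple over fewer than κ parameters, the op-dimension is 0 or
ω, and it is ω exactly when there is an IRD-pattern of depth 1. Infinite `opR_n` with `n > 0` gives
a binary tree of splittings, hence a half graph of realizations and instances, which is a pattern of
depth 1 (`one_mem_irdDepths_of_opRankInfinite`). Conversely, the position of one movable cut among
`2 ^ n` gaps can be coded by `n` truth values, and inside each gap the situation repeats, so `opR_n`
is infinite for every `n` (`exists_opRankInfinite_of_one_mem`). Sub-additivity of opD is then the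
equation `1 = n₁ + n₂`. -/

theorem exists_strictMono_homogeneous (r : ℕ) (col : (Fin r → ℕ) → Prop) :
    ∃ H : ℕ → ℕ, StrictMono H ∧ ∃ v : Prop, ∀ q : Fin r → ℕ, StrictMono q → (col (H ∘ q) ↔ v) := by
  induction r with
  | zero =>
    exact ⟨id, strictMono_id, col Fin.elim0, fun q _ => by
      rw [Subsingleton.elim (id ∘ q) Fin.elim0]⟩
  | succ r ih =>
    choose H hH v hv using ih
    -- One thinning step: set `g 0` aside and thin the tail until the colour of (`g 0`, rest) is
    -- constant, by the case `r`. On the points `g t 0` set aside along the iteration, the colour of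
    -- a tuple depends only on its first entry, through `V`.
    let K : (ℕ → ℕ) → ℕ → ℕ := fun g =>
      g ∘ Nat.succ ∘ H (fun q => col (Fin.cons (g 0) (g ∘ Nat.succ ∘ q)))
    let g : ℕ → ℕ → ℕ := fun t => Nat.rec id (fun _ g => K g) t
    let V : ℕ → Prop := fun t => v (fun q => col (Fin.cons (g t 0) (g t ∘ Nat.succ ∘ q)))
    have hg : ∀ t, StrictMono (g t) := by
      intro t
      induction t with
      | zero => exact strictMono_id
      | succ t iht => exact iht.comp ((strictMono_id.add_const 1).comp (hH _))
    have hrange : ∀ t d, ∃ z, g (t + d) 0 = g t z := by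
      intro t d
      suffices h : ∀ d x, ∃ z, g (t + d) x = g t z from h d 0
      intro d
      induction d with
      | zero => exact fun x => ⟨x, rfl⟩
      | succ d ihd => exact fun x => ihd _
    have ha : StrictMono (fun t => g t 0) :=
      strictMono_nat_of_lt_succ fun t => hg t (Nat.succ_pos _)
    have key : ∀ (t : ℕ) (q : Fin r → ℕ), StrictMono q → (∀ l, t < q l) →
        (col (Fin.cons (g t 0) (fun l => g (q l) 0)) ↔ V t) := by
      intro t q hq hlt
      have h1 : ∀ l, ∃ z, g (q l) 0 = g (t + 1) z := fun l => by
        obtain ⟨d, hd⟩ := Nat.exists_eq_add_of_le (Nat.succ_le_of_lt (hlt l))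
        rw [hd]; exact hrange _ d
      choose z hz using h1
      have hzm : StrictMono z := fun l l' hl => by
        rw [← (hg (t + 1)).lt_iff_lt, ← hz, ← hz]
        exact ha (hq hl)
      have := hv (fun q => col (Fin.cons (g t 0) (g t ∘ Nat.succ ∘ q))) z hzm
      refine Iff.trans ?_ this
      have e : (fun l => g (q l) 0) = g t ∘ Nat.succ ∘
          H (fun q => col (Fin.cons (g t 0) (g t ∘ Nat.succ ∘ q))) ∘ z := funext fun l => hz l
      rw [e]
    have fin : ∀ (p : ℕ → ℕ) (u : Prop), StrictMono p → (∀ t, V (p t) ↔ u) →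
        ∃ H : ℕ → ℕ, StrictMono H ∧ ∃ v : Prop,
          ∀ q : Fin (r + 1) → ℕ, StrictMono q → (col (H ∘ q) ↔ v) := by
      intro p u hp hu
      refine ⟨fun t => g (p t) 0, ha.comp hp, u, fun q hq => ?_⟩
      rw [← hu (q 0), ← key (p (q 0)) (fun l => p (q l.succ))
        (hp.comp (hq.comp Fin.strictMono_succ)) (fun l => hp (hq (Fin.succ_pos l)))]
      apply iff_of_eq
      congr 1
      funext l
      refine Fin.cases rfl (fun l => rfl) l
    by_cases hf : ∃ᶠ t in Filter.atTop, V t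
    · obtain ⟨p, hp, hpv⟩ := Filter.extraction_of_frequently_atTop hf
      exact fin p True hp (by simpa using hpv)
    · rw [Filter.not_frequently, Filter.eventually_atTop] at hf
      obtain ⟨N, hN⟩ := hf
      exact fin (fun t => N + t) False (strictMono_id.const_add N)
        (fun t => by simpa using hN _ (Nat.le_add_right _ _))

theorem exists_strictMono_homogeneous_finset {K : Type*} (t : Finset K) (r : K → ℕ)
    (col : ∀ k, (Fin (r k) → ℕ) → Prop) :
    ∃ H : ℕ → ℕ, StrictMono H ∧ ∀ k ∈ t, ∀ q q' : Fin (r k) → ℕ, StrictMono q → StrictMono q' →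
      (col k (H ∘ q) ↔ col k (H ∘ q')) := by
  classical
  induction t using Finset.induction_on with
  | empty => exact ⟨id, strictMono_id, by simp⟩
  | insert k t _ ih =>
    obtain ⟨H, hH, h⟩ := ih
    obtain ⟨H', hH', v, hv⟩ := exists_strictMono_homogeneous (r k) (fun q => col k (H ∘ q))
    refine ⟨H ∘ H', hH.comp hH', fun k' hk' q q' hq hq' => ?_⟩
    rcases Finset.mem_insert.1 hk' with rfl | hk'
    · exact (hv q hq).trans (hv q' hq').symm
    · exact h k' hk' (H' ∘ q) (H' ∘ q') (hH'.comp hq) (hH'.comp hq')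

end Ramsey

/-! ### Definable sets: projections and fibers. -/

section Definability

variable {L : FirstOrder.Language.{u, v}} {U : Type w} [L.Structure U]

theorem definable_of_mem_formulasOver {α : Type x} {A : Set U} {φ : L[[U]].Formula α}
    (h : φ ∈ formulasOver L α A) : A.Definable L {a | φ.Realize a} := by
  obtain ⟨ψ, rfl⟩ := h
  have : (L.lhomWithConstantsMap (Subtype.val : A → U)).IsExpansionOn U :=
    have := constantsOnMap_isExpansionOn (M := U) (f := (Subtype.val : A → U))
      (fα := fun a : A => (a : U)) (fβ := id) rfl
    LHom.sumMap_isExpansionOn _ _ _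
  exact ⟨ψ, by ext a; simp [LHom.realize_onFormula]⟩

theorem exists_mem_formulasOver {α : Type x} {A : Set U} {S : Set (α → U)}
    (h : A.Definable L S) : ∃ φ ∈ formulasOver L α A, ∀ a, φ.Realize a ↔ a ∈ S := by
  obtain ⟨ψ, rfl⟩ := h
  have : (L.lhomWithConstantsMap (Subtype.val : A → U)).IsExpansionOn U :=
    have := constantsOnMap_isExpansionOn (M := U) (f := (Subtype.val : A → U))
      (fα := fun a : A => (a : U)) (fβ := id) rfl
    LHom.sumMap_isExpansionOn _ _ _
  exact ⟨_, ⟨ψ, rfl⟩, fun a => by simp [LHom.realize_onFormula]⟩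

theorem definable_univ_of_formula {α : Type x} (φ : L[[U]].Formula α) :
    (univ : Set U).Definable L {a | φ.Realize a} := by
  have : (L.lhomWithConstantsMap (fun a : U => (⟨a, trivial⟩ : (univ : Set U)))).IsExpansionOn U :=
    have := constantsOnMap_isExpansionOn (M := U)
      (f := (fun a : U => (⟨a, trivial⟩ : (univ : Set U))))
      (fα := id) (fβ := fun a : (univ : Set U) => (a : U)) rfl
    LHom.sumMap_isExpansionOn _ _ _
  exact ⟨(L.lhomWithConstantsMap (fun a : U => (⟨a, trivial⟩ : (univ : Set U)))).onFormula φ,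
    by ext a; simp⟩

/-- A definable set only depends on finitely many coordinates. -/
theorem _root_.Set.Definable.exists_finset {ι : Type x} {A : Set U} {S : Set (ι → U)}
    (h : A.Definable L S) :
    ∃ F : Finset ι, ∀ w w' : ι → U, (∀ i ∈ F, w i = w' i) → w ∈ S → w' ∈ S := by
  classical
  obtain ⟨φ, rfl⟩ := h
  refine ⟨φ.freeVarFinset, fun w w' hw h => ?_⟩
  have key : ∀ w : ι → U, Formula.Realize (φ.restrictFreeVar (id : φ.freeVarFinset → _))
      (fun i : φ.freeVarFinset => w i) ↔ φ.Realize w := fun w =>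
    BoundedFormula.realize_restrictFreeVar (f := (id : φ.freeVarFinset → _)) _ (by simp)
  have e : (fun i : φ.freeVarFinset => w i) = fun i : φ.freeVarFinset => w' i :=
    funext fun i => hw i i.2
  exact (key w').1 (e ▸ (key w).2 h)

/-- `ι` may be infinite: `G` depends on finitely many coordinates only, so all others can be
identified with one dummy coordinate `none`, which leaves a finite quantifier. -/
theorem definable_exists {γ : Type*} {ι : Type*} {A : Set U} {G : Set (γ ⊕ ι → U)}
    (h : A.Definable L G) : A.Definable L {z : γ → U | ∃ w : ι → U, Sum.elim z w ∈ G} := by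
  classical
  obtain ⟨F, hF⟩ := h.exists_finset
  -- The dummy coordinate needs a value `d`, so an empty structure is treated apart.
  rcases isEmpty_or_nonempty U with hU | ⟨⟨d⟩⟩
  · rcases isEmpty_or_nonempty ι with hι | ⟨⟨i⟩⟩
    · exact Definable.exists_of_finite h
    · convert definable_empty (A := A) (L := L) (M := U) (α := γ)
      simp only [eq_empty_iff_forall_notMem, mem_ofPred_eq]
      rintro z ⟨w, _⟩
      exact hU.elim (w i)
  · let F' : Finset ι := F.preimage Sum.inr Sum.inr_injective.injOn
    let g : ι → Option F' := fun i => if h : i ∈ F' then some ⟨i, h⟩ else none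
    convert (h.preimage_comp (Sum.map id g : γ ⊕ ι → γ ⊕ Option F')).exists_of_finite using 1
    ext z
    simp only [mem_ofPred_eq, mem_preimage]
    constructor
    · rintro ⟨w, hw⟩
      refine ⟨fun o => o.elim d (fun i => w i), hF _ _ ?_ hw⟩
      rintro (i | i) hi
      · rfl
      · have hi' : i ∈ F' := Finset.mem_preimage.2 hi
        simp [g, hi']
    · rintro ⟨w, hw⟩
      refine ⟨w ∘ g, ?_⟩
      convert hw using 1
      ext (i | i) <;> rfl

/-- The fiber is the projection of `G` intersected with the finitely many equations that fix the
first block of variables at `a`. -/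
theorem definable_fiber {α : Type*} [Finite α] {γ : Type*} {A : Set U} (a : α → U) {G : Set (α ⊕ γ → U)}
    (h : A.Definable L G) : (A ∪ range a).Definable L {z : γ → U | Sum.elim a z ∈ G} := by
  have hG : (A ∪ range a).Definable L
      {v : γ ⊕ α → U | v ∘ Sum.swap ∈ G ∧ ∀ i, v (Sum.inr i) = a i} := by
    have h1 := (h.mono (subset_union_left (t := range a))).preimage_comp
      (Sum.swap : α ⊕ γ → γ ⊕ α)
    have h2 : ∀ i : α, (A ∪ range a).Definable L
        {v : γ ⊕ α → U | v (Sum.inr i) = a i} := fun i => by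
      have := (Definable.singleton_of_mem (L := L) (A := A ∪ range a) (a := a i)
        (Or.inr ⟨i, rfl⟩)).preimage_comp (fun _ : Fin 1 => (Sum.inr i : γ ⊕ α))
      convert this using 1
      ext v
      simp
    convert h1.inter (definable_iInter_of_finite h2) using 1
    ext v
    simp
  convert definable_exists hG using 1
  ext z
  simp only [mem_ofPred_eq, Sum.elim_inr]
  constructor
  · intro hz
    refine ⟨a, ?_, fun _ => rfl⟩
    convert hz using 1
    ext (i | i) <;> rfl
  · rintro ⟨w, hw, hwa⟩
    obtain rfl : w = a := funext hwa
    convert hw using 1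
    ext (i | i) <;> rfl

/-- A set definable over `A ∪ range a` is the fiber at `a` of a set definable over `A`. -/
theorem exists_definable_fiber {α : Type*} {γ : Type*} {A : Set U} {a : α → U} {S : Set (γ → U)}
    (h : (A ∪ range a).Definable L S) :
    ∃ G : Set (α ⊕ γ → U), A.Definable L G ∧ ∀ z, z ∈ S ↔ Sum.elim a z ∈ G := by
  classical
  obtain ⟨φ, rfl⟩ := definable_iff_exists_formula_sum.1 h
  have hc : ∀ x : (A ∪ range a : Set U), (x : U) ∉ A → ∃ i, a i = x := fun x hx =>
    x.2.resolve_left hx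
  choose f hf using hc
  let ρ : (A ∪ range a : Set U) ⊕ γ → A ⊕ (α ⊕ γ) :=
    Sum.elim (fun x => if hx : (x : U) ∈ A then Sum.inl ⟨x, hx⟩ else Sum.inr (Sum.inl (f x hx)))
      (fun i => Sum.inr (Sum.inr i))
  refine ⟨_, definable_iff_exists_formula_sum.2 ⟨φ.relabel ρ, rfl⟩, fun z => ?_⟩
  simp only [mem_ofPred_eq, Formula.realize_relabel]
  apply iff_of_eq
  congr 1
  ext (x | i)
  · by_cases hx : (x : U) ∈ A
    · simp [ρ, hx]
    · simp [ρ, hx, hf x hx]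
  · simp [ρ]

/-- A set definable with parameters is the fiber, at a finite tuple, of a set definable without
parameters. -/
theorem exists_empty_definable_fiber {γ : Type*} {A : Set U} {S : Set (γ → U)}
    (h : A.Definable L S) :
    ∃ (p : ℕ) (e : Fin p → U) (G : Set (Fin p ⊕ γ → U)), (∅ : Set U).Definable L G ∧
      ∀ z, z ∈ S ↔ Sum.elim e z ∈ G := by
  obtain ⟨A₀, _, hS⟩ := definable_iff_finitely_definable.1 h
  have e := A₀.equivFin
  refine ⟨A₀.card, fun i => e.symm i, exists_definable_fiber ?_⟩
  convert hS using 1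
  ext x
  simp only [empty_union, mem_range]
  exact ⟨fun ⟨i, hi⟩ => hi ▸ (e.symm i).2, fun hx => ⟨e ⟨x, hx⟩, by simp⟩⟩

theorem _root_.Set.Definable.iff {γ : Type*} {A : Set U} {S T : Set (γ → U)}
    (hS : A.Definable L S) (hT : A.Definable L T) :
    A.Definable L {z | z ∈ S ↔ z ∈ T} := by
  convert (hS.inter hT).union (hS.compl.inter hT.compl) using 1
  ext z
  simp only [mem_ofPred_eq, mem_union, mem_inter_iff, mem_compl_iff]
  tauto

theorem definable_const {γ : Type*} {A : Set U} (p : Prop) :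
    A.Definable L {_z : γ → U | p} := by
  by_cases h : p
  · simp [h]
  · simp [h]

end Definability

/-! ### Saturation, from one variable to countably many. -/

section Saturation

variable {L : FirstOrder.Language.{u, v}} {U : Type w} [L.Structure U]

theorem definable_eq_const {γ : Type*} {A : Set U} (i : γ) {a : U} (ha : a ∈ A) :
    A.Definable L {z : γ → U | z i = a} := by
  convert (Definable.singleton_of_mem (L := L) ha).preimage_comp (fun _ : Fin 1 => i) using 1
  ext z
  simp

theorem definable_eq_coord {γ : Type*} {A : Set U} (i j : γ) :
    A.Definable L {z : γ → U | z i = z j} := by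
  refine definable_iff_exists_formula_sum.2
    ⟨Term.equal (Term.var (Sum.inr i)) (Term.var (Sum.inr j)), ?_⟩
  ext z
  simp [Formula.realize_equal]

theorem mk_union_range_lt {κ : Cardinal.{w}} (hκ : ℵ₀ ≤ κ) {A : Set U} (hA : #A < κ) {α : Type*}
    [Finite α] (a : α → U) : #(A ∪ range a : Set U) < κ :=
  (mk_union_le _ _).trans_lt
    (add_lt_of_lt hκ hA ((lt_aleph0_of_finite _).trans_le hκ))

variable {κ : Cardinal.{w}} {A : Set U} {K : Type*}

theorem IsSaturated.exists_fin_one (hU : IsSaturated L U κ) (hA : #A < κ)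
    {C : K → Set (Fin 1 → U)} (hC : ∀ k, A.Definable L (C k))
    (hfin : ∀ t : Finset K, ∃ z, ∀ k ∈ t, z ∈ C k) : ∃ z, ∀ k, z ∈ C k := by
  classical
  choose φ hφ hφC using fun k => exists_mem_formulasOver (hC k)
  obtain ⟨z, hz⟩ := hU A hA (range φ) (by rintro _ ⟨k, rfl⟩; exact hφ k) (by
    intro s hs
    choose k hk using fun ψ : s => hs ψ.2
    obtain ⟨z, hz⟩ := hfin (s.attach.image k)
    refine ⟨z, fun ψ hψ => ?_⟩
    have := (hφC _ z).2 (hz _ (Finset.mem_image_of_mem k (Finset.mem_attach s ⟨ψ, hψ⟩)))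
    rwa [hk] at this)
  exact ⟨z, fun k => (hφC k z).1 (hz _ ⟨k, rfl⟩)⟩

/-- Solvability of finitely many conditions, with the first `m` coordinates fixed and coordinate `m`
equal to `z`, is a condition on `z` over fewer than κ parameters; saturation in one variable gives a
common `z`. -/
theorem IsSaturated.extend_realization (hκ : ℵ₀ ≤ κ) (hU : IsSaturated L U κ) (hA : #A < κ)
    {C : K → Set (ℕ → U)} (hC : ∀ k, A.Definable L (C k)) (m : ℕ) (v : ℕ → U)
    (hfin : ∀ t : Finset K, ∃ w : ℕ → U, (∀ k ∈ t, w ∈ C k) ∧ ∀ i < m, w i = v i) :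
    ∃ v' : ℕ → U, (∀ i < m, v' i = v i) ∧
      ∀ t : Finset K, ∃ w : ℕ → U, (∀ k ∈ t, w ∈ C k) ∧ ∀ i < m + 1, w i = v' i := by
  classical
  let a : Fin m → U := fun i => v i
  have hdef : ∀ t : Finset K, (A ∪ range a).Definable L {z : Fin 1 → U | ∃ w : ℕ → U,
      Sum.elim z w ∈ {x : Fin 1 ⊕ ℕ → U | (∀ k ∈ t, x ∘ Sum.inr ∈ C k) ∧
        (∀ i : Fin m, x (Sum.inr i) = a i) ∧ x (Sum.inr m) = x (Sum.inl 0)}} := fun t => by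
    refine definable_exists ?_
    have h1 := definable_biInter_finset
      (fun k => ((hC k).mono (subset_union_left (t := range a))).preimage_comp
        (Sum.inr : ℕ → Fin 1 ⊕ ℕ)) t
    have h2 := definable_iInter_of_finite fun i : Fin m =>
      definable_eq_const (L := L) (A := A ∪ range a) (γ := Fin 1 ⊕ ℕ) (Sum.inr i) (a := a i)
        (Or.inr ⟨i, rfl⟩)
    convert h1.inter (h2.inter (definable_eq_coord (Sum.inr m) (Sum.inl 0))) using 1
    ext x
    simp
  obtain ⟨z, hz⟩ := hU.exists_fin_one (mk_union_range_lt hκ hA a) hdef (fun T => by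
    obtain ⟨w, hw, hwv⟩ := hfin (T.biUnion id)
    exact ⟨fun _ => w m, fun t ht => ⟨w, fun k hk => hw k (Finset.mem_biUnion.2 ⟨t, ht, hk⟩),
      fun i => hwv i i.2, rfl⟩⟩)
  refine ⟨Function.update v m (z 0), fun i hi => Function.update_of_ne hi.ne _ _, fun t => ?_⟩
  obtain ⟨w, hw, hwv, hwm⟩ := hz t
  refine ⟨w, hw, fun i hi => ?_⟩
  rcases Nat.lt_succ_iff_lt_or_eq.1 hi with hi | rfl
  · rw [Function.update_of_ne hi.ne]
    exact hwv ⟨i, hi⟩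
  · rw [Function.update_self]
    exact hwm

/-- Coordinates are fixed one at a time while finite satisfiability is kept. The limit works because
each `C k` sees only finitely many coordinates. -/
theorem IsSaturated.exists_nat (hκ : ℵ₀ ≤ κ) (hU : IsSaturated L U κ) (hA : #A < κ)
    {C : K → Set (ℕ → U)} (hC : ∀ k, A.Definable L (C k))
    (hfin : ∀ t : Finset K, ∃ w, ∀ k ∈ t, w ∈ C k) : ∃ w, ∀ k, w ∈ C k := by
  classical
  let P : ℕ → (ℕ → U) → Prop := fun m v =>
    ∀ t : Finset K, ∃ w : ℕ → U, (∀ k ∈ t, w ∈ C k) ∧ ∀ i < m, w i = v i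
  choose f hf hfP using fun (m : ℕ) (v : {v // P m v}) =>
    hU.extend_realization hκ hA hC m v.1 v.2
  obtain ⟨w₀, -⟩ := hfin ∅
  let g : ∀ m, {v // P m v} := fun m => Nat.rec
    ⟨w₀, fun t => (hfin t).imp fun w hw => ⟨hw, fun i hi => absurd hi (Nat.not_lt_zero i)⟩⟩
    (fun m v => ⟨f m v, hfP m v⟩) m
  have hg : ∀ m d i, i < m → (g (m + d)).1 i = (g m).1 i := by
    intro m d i hi
    induction d with
    | zero => rfl
    | succ d ih => exact (hf (m + d) (g (m + d)) i (by omega)).trans ih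
  refine ⟨fun i => (g (i + 1)).1 i, fun k => ?_⟩
  obtain ⟨F, hF⟩ := (hC k).exists_finset
  obtain ⟨w, hw, hwv⟩ := (g (F.sup id + 1)).2 {k}
  refine hF w _ (fun i hi => ?_) (hw k (Finset.mem_singleton_self k))
  have hi' : i ≤ F.sup id := Finset.le_sup (f := id) hi
  obtain ⟨d, hd⟩ := Nat.exists_eq_add_of_le (Nat.succ_le_succ hi')
  rw [hwv i (by omega), show F.sup id + 1 = i + 1 + d from hd, hg _ _ _ (Nat.lt_succ_self i)]

/-- Saturation for partial types in countably many variables. -/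
theorem IsSaturated.exists_countable (hκ : ℵ₀ ≤ κ) (hU : IsSaturated L U κ) (hA : #A < κ)
    {ι : Type*} [Countable ι] {C : K → Set (ι → U)} (hC : ∀ k, A.Definable L (C k))
    (hfin : ∀ t : Finset K, ∃ w, ∀ k ∈ t, w ∈ C k) : ∃ w, ∀ k, w ∈ C k := by
  obtain ⟨e, he⟩ := exists_injective_nat ι
  rcases isEmpty_or_nonempty U with hE | ⟨⟨d⟩⟩
  · obtain ⟨w, -⟩ := hfin ∅
    refine ⟨w, fun k => ?_⟩
    obtain ⟨w', hw'⟩ := hfin {k}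
    rw [Subsingleton.elim w w']
    exact hw' k (Finset.mem_singleton_self k)
  · obtain ⟨w, hw⟩ := hU.exists_nat hκ hA (fun k => (hC k).preimage_comp e) (fun t => by
      obtain ⟨w, hw⟩ := hfin t
      refine ⟨Function.extend e w fun _ => d, fun k hk => ?_⟩
      have : Function.extend e w (fun _ => d) ∘ e = w := funext fun i => he.extend_apply w _ i
      rw [mem_preimage, this]
      exact hw k hk)
    exact ⟨w ∘ e, hw⟩

/-- A family of conditions on `(x, w)` over `A` that is finitely satisfiable with `x` in any given
`A`-definable neighbourhood of `c` is satisfiable with `x = c`. -/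
theorem IsSaturated.exists_countable_over_tuple (hκ : ℵ₀ ≤ κ) (hU : IsSaturated L U κ)
    (hA : #A < κ) {α : Type*} [Finite α] (c : α → U) {ι : Type*} [Countable ι]
    {G : K → Set (α ⊕ ι → U)} (hG : ∀ k, A.Definable L (G k))
    (hfin : ∀ (t : Finset K) (C : Set (α → U)), A.Definable L C → c ∈ C →
      ∃ c' ∈ C, ∃ w, ∀ k ∈ t, Sum.elim c' w ∈ G k) : ∃ w, ∀ k, Sum.elim c w ∈ G k := by
  refine hU.exists_countable hκ (mk_union_range_lt hκ hA c)
    (C := fun k => {w | Sum.elim c w ∈ G k}) (fun k => definable_fiber c (hG k)) (fun t => ?_)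
  by_contra hc
  -- If `c` had no solution for `t`, the tuples without one would form an `A`-definable
  -- neighbourhood of `c`.
  have hdef := (definable_exists (definable_biInter_finset hG t)).compl
  obtain ⟨c', hc', w, hw⟩ := hfin t _ hdef (by
    rintro ⟨w, hw⟩
    exact hc ⟨w, by simpa using hw⟩)
  exact hc' ⟨w, by simpa using hw⟩

end Saturation

/-! ### IRD-patterns in complete types, in terms of definable sets. -/

section Patterns

variable {L : FirstOrder.Language.{u, v}} {U : Type w} [L.Structure U] {α : Type x}

/-- The depths of IRD-patterns of length `ω` in `π`. -/
def irdDepths (π : PartialType L U α) : Set ℕ :=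
  {n | ∃ (ψ : Fin n → PartitionedFormula L U α) (b : ∀ i : Fin n, ℕ → Fin (ψ i).1 → U),
    IsIRDPattern π ψ b}

theorem IsIRDPattern.exists_mem {c : α → U} {B : Set U} {n : ℕ}
    {ψ : Fin n → PartitionedFormula L U α} {b : ∀ i : Fin n, ℕ → Fin (ψ i).1 → U}
    (h : IsIRDPattern (tp L c B) ψ b) {C : Set (α → U)} (hC : B.Definable L C) (hc : c ∈ C)
    (f : Fin n → ℕ) (N : ℕ) :
    ∃ c' ∈ C, ∀ i, ∀ j < N, ((ψ i).2.Realize (Sum.elim c' (b i j)) ↔ f i ≤ j) := by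
  classical
  obtain ⟨φ, hφ, hφC⟩ := exists_mem_formulasOver hC
  let θ : Fin n × ℕ → L[[U]].Formula α := fun p =>
    if f p.1 ≤ p.2 then (ψ p.1).inst (b p.1 p.2) else ((ψ p.1).inst (b p.1 p.2)).not
  obtain ⟨c', hc'⟩ := h f (insert φ ((Finset.univ ×ˢ Finset.range N).image θ)) (by
    intro χ hχ
    rcases Finset.mem_insert.1 (Finset.mem_coe.1 hχ) with rfl | hχ
    · exact Or.inl (Or.inl ⟨hφ, (hφC c).2 hc⟩)
    · obtain ⟨⟨i, j⟩, -, rfl⟩ := Finset.mem_image.1 hχ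
      by_cases hij : f i ≤ j
      · exact Or.inr ⟨i, j, hij, by simp [θ, hij]⟩
      · exact Or.inl (Or.inr ⟨i, j, not_le.1 hij, by simp [θ, hij]⟩))
  refine ⟨c', (hφC c').1 (hc' φ (Finset.mem_insert_self _ _)), fun i j hj => ?_⟩
  have := hc' (θ (i, j)) (Finset.mem_insert_of_mem (Finset.mem_image_of_mem _ (by simpa using hj)))
  rw [← PartitionedFormula.realize_inst]
  by_cases hij : f i ≤ j
  · simpa [θ, hij] using this
  · simpa [θ, hij] using this

/-- Row `j` concatenates, over all `i`, the parameters hidden in `ψ i` with the tuple `b i j`. All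
`n` conditions then concern one sequence and need no further parameters, so a single indiscernible
sequence will serve them all. -/
theorem exists_rows_of_mem_irdDepths {c : α → U} {B : Set U} {n : ℕ}
    (h : n ∈ irdDepths (tp L c B)) :
    ∃ (Y : Type) (_ : Finite Y) (D : Fin n → Set (α ⊕ Y → U)) (R : ℕ → Y → U),
      (∀ i, (∅ : Set U).Definable L (D i)) ∧
      ∀ C : Set (α → U), B.Definable L C → c ∈ C → ∀ (f : Fin n → ℕ) (N : ℕ),
        ∃ c' ∈ C, ∀ i, ∀ j < N, (Sum.elim c' (R j) ∈ D i ↔ f i ≤ j) := by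
  obtain ⟨ψ, b, hb⟩ := h
  choose p e G hG hGe using fun i =>
    exists_empty_definable_fiber (definable_univ_of_formula (ψ i).2)
  let Y := Σ i : Fin n, Fin (p i) ⊕ Fin (ψ i).1
  let ρ : ∀ i, Fin (p i) ⊕ (α ⊕ Fin (ψ i).1) → α ⊕ Y := fun i =>
    Sum.elim (fun l => Sum.inr ⟨i, Sum.inl l⟩)
      (Sum.elim Sum.inl (fun l => Sum.inr ⟨i, Sum.inr l⟩))
  refine ⟨Y, inferInstance, fun i => (fun z => z ∘ ρ i) ⁻¹' G i,
    fun j y => Sum.elim (e y.1) (b y.1 j) y.2, fun i => (hG i).preimage_comp _, ?_⟩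
  intro C hC hc f N
  obtain ⟨c', hc', hN⟩ := hb.exists_mem hC hc f N
  refine ⟨c', hc', fun i j hj => ?_⟩
  rw [← hN i j hj, mem_preimage]
  have := hGe i (Sum.elim c' (b i j))
  rw [mem_ofPred_eq] at this
  rw [this]
  apply iff_of_eq
  congr 1
  ext (l | l | l) <;> rfl

theorem exists_definable_of_subset_tp {c : α → U} {B : Set U} {s : Finset (L[[U]].Formula α)}
    (hs : (s : Set (L[[U]].Formula α)) ⊆ tp L c B) :
    ∃ C : Set (α → U), B.Definable L C ∧ c ∈ C ∧ ∀ c' ∈ C, ∀ φ ∈ s, φ.Realize c' := by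
  have h := definable_iInter_of_finite fun φ : s =>
    definable_of_mem_formulasOver (hs φ.2).1
  exact ⟨_, h, mem_iInter.2 fun φ => (hs φ.2).2, fun c' hc' φ hφ => mem_iInter.1 hc' ⟨φ, hφ⟩⟩

/-- A finite part of the required type involves a definable neighbourhood of `c` and finitely many
rows. The sets `D i` may use any parameters, since formulas of a pattern may. -/
theorem card_mem_irdDepths {c : α → U} {B : Set U} {I : Type*} [Fintype I] {Y : Type*} [Finite Y]
    {A : I → Set U} {D : I → Set (α ⊕ Y → U)} (hD : ∀ i, (A i).Definable L (D i))
    (b : I → ℕ → Y → U)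
    (h : ∀ C : Set (α → U), B.Definable L C → c ∈ C → ∀ (f : I → ℕ) (N : ℕ),
      ∃ c' ∈ C, ∀ i, ∀ j < N, (Sum.elim c' (b i j) ∈ D i ↔ f i ≤ j)) :
    Fintype.card I ∈ irdDepths (tp L c B) := by
  classical
  obtain ⟨k, ⟨eY⟩⟩ := Finite.exists_equiv_fin Y
  let eI := Fintype.equivFin I
  choose φ hφ hφD using fun i => exists_mem_formulasOver
    ((hD i).preimage_comp (Sum.map id eY : α ⊕ Y → α ⊕ Fin k))
  refine ⟨fun i => ⟨k, φ (eI.symm i)⟩, fun i j => b (eI.symm i) j ∘ eY.symm, fun f s hs => ?_⟩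
  have hreal : ∀ (i) (j) (c' : α → U), (PartitionedFormula.inst (L := L) (U := U) (α := α)
      ⟨k, φ (eI.symm i)⟩ (b (eI.symm i) j ∘ eY.symm)).Realize c' ↔
        Sum.elim c' (b (eI.symm i) j) ∈ D (eI.symm i) := fun i j c' => by
    rw [PartitionedFormula.realize_inst, hφD, mem_preimage]
    apply iff_of_eq
    congr 1
    ext (l | l) <;> simp
  have hN : ∀ θ : s, ∃ N : ℕ, ∀ c' : α → U,
      (∀ i, ∀ j < N, (Sum.elim c' (b (eI.symm i) j) ∈ D (eI.symm i) ↔ f i ≤ j)) →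
      (∀ χ ∈ s, χ ∈ tp L c B → χ.Realize c') → θ.1.Realize c' := by
    rintro ⟨θ, hθ⟩
    rcases hs hθ with (hθ' | ⟨i, j, hij, rfl⟩) | ⟨i, j, hij, rfl⟩
    · exact ⟨0, fun c' _ h2 => h2 θ hθ hθ'⟩
    · refine ⟨j + 1, fun c' h1 _ => ?_⟩
      rw [Formula.realize_not, hreal, h1 i j (Nat.lt_succ_self j)]
      exact not_le.2 hij
    · refine ⟨j + 1, fun c' h1 _ => ?_⟩
      rw [hreal, h1 i j (Nat.lt_succ_self j)]
      exact hij
  choose N hN using hN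
  obtain ⟨C, hC, hcC, hCs⟩ := exists_definable_of_subset_tp (c := c) (B := B)
    (s := s.filter fun χ => χ ∈ tp L c B) (fun χ hχ => (Finset.mem_filter.1 hχ).2)
  obtain ⟨c', hc', hcN⟩ := h C hC hcC (fun i => f (eI i)) (Finset.univ.sup N)
  refine ⟨c', fun θ hθ => hN ⟨θ, hθ⟩ c' (fun i j hj => ?_) (fun χ hχ hχ' => ?_)⟩
  · have := hcN (eI.symm i) j (hj.trans_le (Finset.le_sup (Finset.mem_univ _)))
    simpa using this
  · exact hCs c' hc' χ (Finset.mem_filter.2 ⟨hχ, hχ'⟩)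

end Patterns

/-! ### Indiscernible sequences indexed by ℚ, their blocks and cuts. -/

section Indiscernibles

variable {L : FirstOrder.Language.{u, v}} {U : Type w} [L.Structure U] {Y : Type}

/-- The rows `R q`, `q ∈ ℚ`, form a sequence of indiscernibles over `B`. -/
def Indisc (L : FirstOrder.Language.{u, v}) {U : Type w} [L.Structure U] {Y : Type} (B : Set U)
    (R : ℚ → Y → U) : Prop :=
  ∀ (r : ℕ) (E : Set (Fin r × Y → U)), B.Definable L E → ∀ s s' : Fin r → ℚ,
    StrictMono s → StrictMono s' →
      ((fun p => R (s p.1) p.2) ∈ E ↔ (fun p => R (s' p.1) p.2) ∈ E)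

/-- The blocks `[p, p + 1)`, `p ∈ ℤ`, of the sequence `R` are mutually indiscernible over `B`. -/
def BlockIndisc (L : FirstOrder.Language.{u, v}) {U : Type w} [L.Structure U] {Y : Type}
    (B : Set U) (R : ℚ → Y → U) : Prop :=
  ∀ (r : ℕ) (E : Set (Fin r × Y → U)), B.Definable L E → ∀ s s' : Fin r → ℚ,
    StrictMono s → StrictMono s' → (∀ l, ⌊s l⌋ = ⌊s' l⌋) →
      ((fun p => R (s p.1) p.2) ∈ E ↔ (fun p => R (s' p.1) p.2) ∈ E)

/-- `c` cuts the sequence `R` at `2 i + 1` by means of `D i`, for each `i`. -/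
def Cuts {α : Type x} {n : ℕ} (D : Fin n → Set (α ⊕ Y → U)) (c : α → U) (R : ℚ → Y → U) : Prop :=
  ∀ (i : Fin n) (q : ℚ), (⌊q⌋ = 2 * (i : ℤ) → Sum.elim c (R q) ∉ D i) ∧
    (⌊q⌋ = 2 * (i : ℤ) + 1 → Sum.elim c (R q) ∈ D i)

/-- `e x` counts the elements of `F` below `x`. Only `q` has to lie in `F`, so a cut point outside
`F` can be ranked as well. -/
theorem exists_rank (F : Finset ℚ) : ∃ e : ℚ → ℕ, ∀ q ∈ F, ∀ x, e q < e x ↔ q < x := by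
  have hmono : Monotone fun x : ℚ => (F.filter (· < x)).card := fun q q' h =>
    Finset.card_le_card fun z hz => by
      simp only [Finset.mem_filter] at hz ⊢
      exact ⟨hz.1, hz.2.trans_le h⟩
  refine ⟨fun x => (F.filter (· < x)).card, fun q hq x => ⟨fun h => ?_, fun h => ?_⟩⟩
  · by_contra hx
    exact absurd h (not_lt.2 (hmono (not_lt.1 hx)))
  · refine Finset.card_lt_card (Finset.ssubset_iff_of_subset ?_ |>.2 ⟨q, ?_, ?_⟩)
    · intro z hz
      simp only [Finset.mem_filter] at hz ⊢
      exact ⟨hz.1, hz.2.trans h⟩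
    · simpa using ⟨hq, h⟩
    · simp

/-- The `t`-th term of an increasing sequence in the block `[p, p + 1)`. -/
def blockPoint (p : ℤ) (t : ℕ) : ℚ := p + (1 - 1 / (t + 1))

theorem le_blockPoint (p : ℤ) (t : ℕ) : (p : ℚ) ≤ blockPoint p t := by
  have : (1 : ℚ) / (t + 1) ≤ 1 := by
    rw [div_le_one (by positivity)]
    linarith [(Nat.cast_nonneg t : (0 : ℚ) ≤ t)]
  unfold blockPoint
  linarith

theorem blockPoint_lt (p : ℤ) (t : ℕ) : blockPoint p t < p + 1 := by
  have : (0 : ℚ) < 1 / (t + 1) := by positivity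
  unfold blockPoint
  linarith

theorem floor_blockPoint (p : ℤ) (t : ℕ) : ⌊blockPoint p t⌋ = p :=
  Int.floor_eq_iff.2 ⟨le_blockPoint p t, blockPoint_lt p t⟩

theorem blockPoint_strictMono (p : ℤ) : StrictMono (blockPoint p) := fun t t' h => by
  have : (1 : ℚ) / (t' + 1) < 1 / (t + 1) := by
    apply one_div_lt_one_div_of_lt (by positivity)
    exact_mod_cast Nat.succ_lt_succ h
  unfold blockPoint
  linarith

theorem blockPoint_lt_blockPoint {p p' : ℤ} {t t' : ℕ} (hp : p ≤ p') (ht : t < t') :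
    blockPoint p t < blockPoint p' t' := by
  rcases hp.eq_or_lt with rfl | hp
  · exact blockPoint_strictMono p ht
  · have : (p : ℚ) + 1 ≤ p' := by exact_mod_cast hp
    linarith [blockPoint_lt p t, le_blockPoint p' t']

end Indiscernibles

/-! ### Extraction of indiscernible sequences that keep their cuts. -/

section Extraction

variable {L : FirstOrder.Language.{u, v}} {U : Type w} [L.Structure U] {Y : Type}

theorem definable_imp {γ : Type*} {A : Set U} (p : Prop) {S : Set (γ → U)}
    (hS : A.Definable L S) : A.Definable L {z : γ → U | p → z ∈ S} := by
  by_cases h : p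
  · simpa [h] using! hS
  · simp [h]

/-- Membership in `E` does not change when the rows `s` are replaced by the rows `s'`. -/
def sameTruth {r : ℕ} (E : Set (Fin r × Y → U)) (s s' : Fin r → ℚ) : Set (ℚ × Y → U) :=
  {z | (fun p : Fin r × Y => z (s p.1, p.2)) ∈ E ↔ (fun p : Fin r × Y => z (s' p.1, p.2)) ∈ E}

theorem definable_sameTruth {A : Set U} {r : ℕ} {E : Set (Fin r × Y → U)} (hE : A.Definable L E)
    (s s' : Fin r → ℚ) : A.Definable L (sameTruth E s s') :=
  (hE.preimage_comp (fun p : Fin r × Y => (s p.1, p.2))).iff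
    (hE.preimage_comp (fun p : Fin r × Y => (s' p.1, p.2)))

/-- The condition that `D i` be cut at `2 i + 1`, for the single row `q`. -/
def cutsAt {α : Type x} (i : ℕ) (D : Set (α ⊕ Y → U)) (q : ℚ) : Set (α ⊕ (ℚ × Y) → U) :=
  {z | (⌊q⌋ = 2 * (i : ℤ) → z ∈ ((fun z : α ⊕ (ℚ × Y) → U => z ∘ Sum.map id (Prod.mk q)) ⁻¹' D)ᶜ) ∧
    (⌊q⌋ = 2 * (i : ℤ) + 1 → z ∈ (fun z : α ⊕ (ℚ × Y) → U => z ∘ Sum.map id (Prod.mk q)) ⁻¹' D)}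

theorem definable_cutsAt {α : Type x} {A : Set U} (i : ℕ) {D : Set (α ⊕ Y → U)}
    (hD : A.Definable L D) (q : ℚ) : A.Definable L (cutsAt i D q) :=
  (definable_imp _ (hD.preimage_comp _).compl).inter (definable_imp _ (hD.preimage_comp _))

theorem mem_cutsAt {α : Type x} {i : ℕ} {D : Set (α ⊕ Y → U)} {q : ℚ} {c : α → U}
    {w : ℚ × Y → U} : Sum.elim c w ∈ cutsAt i D q ↔
      (⌊q⌋ = 2 * (i : ℤ) → Sum.elim c (fun y => w (q, y)) ∉ D) ∧
      (⌊q⌋ = 2 * (i : ℤ) + 1 → Sum.elim c (fun y => w (q, y)) ∈ D) := by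
  have : (Sum.elim c w ∘ Sum.map id (Prod.mk q) : α ⊕ Y → U) =
      Sum.elim c (fun y => w (q, y)) := by
    ext (l | l) <;> rfl
  simp only [cutsAt, mem_ofPred_eq, mem_compl_iff, mem_preimage, this]

/-- Indices of the conditions that make up indiscernibility. -/
abbrev IndiscIndex (L : FirstOrder.Language.{u, v}) {U : Type w} [L.Structure U] (Y : Type)
    (B : Set U) :=
  Σ r : ℕ, {E : Set (Fin r × Y → U) // B.Definable L E} × {s : Fin r → ℚ // StrictMono s} ×
    {s : Fin r → ℚ // StrictMono s}

/-- The rows that a condition mentions. -/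
def IndiscIndex.rows {B : Set U} (k : IndiscIndex L Y B) : Finset ℚ :=
  Finset.univ.image k.2.2.1.1 ∪ Finset.univ.image k.2.2.2.1

theorem IndiscIndex.left_mem_rows {B : Set U} (k : IndiscIndex L Y B) (l : Fin k.1) :
    k.2.2.1.1 l ∈ k.rows :=
  Finset.mem_union_left _ (Finset.mem_image_of_mem _ (Finset.mem_univ l))

theorem IndiscIndex.right_mem_rows {B : Set U} (k : IndiscIndex L Y B) (l : Fin k.1) :
    k.2.2.2.1 l ∈ k.rows :=
  Finset.mem_union_right _ (Finset.mem_image_of_mem _ (Finset.mem_univ l))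

variable {κ : Cardinal.{w}}

/-- Finitely many conditions mention finitely many rationals; these are sent in order to rows of a
homogeneous subsequence. The pattern supplies a tuple near `c` with the right cuts, and saturation
over `c` replaces it by `c`. -/
theorem exists_indisc_cuts (hκ : ℵ₀ ≤ κ) (hU : IsSaturated L U κ) {B : Set U} (hB : #B < κ)
    {α : Type x} [Finite α] (c : α → U) [Finite Y] {n : ℕ} {D : Fin n → Set (α ⊕ Y → U)}
    (hD : ∀ i, B.Definable L (D i)) (R : ℕ → Y → U)
    (h : ∀ C : Set (α → U), B.Definable L C → c ∈ C → ∀ (f : Fin n → ℕ) (N : ℕ),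
      ∃ c' ∈ C, ∀ i, ∀ j < N, (Sum.elim c' (R j) ∈ D i ↔ f i ≤ j)) :
    ∃ R : ℚ → Y → U, Indisc L B R ∧ Cuts D c R := by
  classical
  let G : IndiscIndex L Y B ⊕ (Fin n × ℚ) → Set (α ⊕ (ℚ × Y) → U) :=
    Sum.elim (fun k => (fun z => z ∘ Sum.inr) ⁻¹' sameTruth k.2.1.1 k.2.2.1.1 k.2.2.2.1)
      (fun k => cutsAt k.1 (D k.1) k.2)
  have hG : ∀ k, B.Definable L (G k) := by
    rintro (k | k)
    · exact (definable_sameTruth k.2.1.2 _ _).preimage_comp _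
    · exact definable_cutsAt _ (hD k.1) _
  obtain ⟨w, hw⟩ := hU.exists_countable_over_tuple hκ hB c hG (fun t C hC hc => by
    obtain ⟨e, he⟩ := exists_rank (t.toLeft.biUnion IndiscIndex.rows ∪ t.toRight.image Prod.snd)
    obtain ⟨H, hH, hhom⟩ := exists_strictMono_homogeneous_finset t.toLeft (fun k => k.1)
      (fun k q => (fun p => R (q p.1) p.2) ∈ k.2.1.1)
    -- The `i`-th cut goes to the image of 2i+1, the boundary between the blocks 2i and 2i+1.
    obtain ⟨c', hc', hcut⟩ := h C hC hc (fun i => H (e (2 * (i : ℤ) + 1 : ℤ)))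
      (t.toRight.sup (fun k => H (e k.2) + 1))
    refine ⟨c', hc', fun p => R (H (e p.1)) p.2, ?_⟩
    rintro (k | ⟨i, q⟩) hk
    · have hk' : k ∈ t.toLeft := Finset.mem_toLeft.2 hk
      refine hhom k hk' (e ∘ k.2.2.1.1) (e ∘ k.2.2.2.1) (fun l l' hl => ?_) (fun l l' hl => ?_)
      · exact (he _ (Finset.mem_union_left _ (Finset.mem_biUnion.2
          ⟨k, hk', k.left_mem_rows l⟩)) _).2 (k.2.2.1.2 hl)
      · exact (he _ (Finset.mem_union_left _ (Finset.mem_biUnion.2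
          ⟨k, hk', k.right_mem_rows l⟩)) _).2 (k.2.2.2.2 hl)
    · have hk' : (i, q) ∈ t.toRight := Finset.mem_toRight.2 hk
      have := hcut i (H (e q)) (Nat.lt_of_succ_le
        (Finset.le_sup (f := fun k : Fin n × ℚ => H (e k.2) + 1) hk'))
      rw [hH.le_iff_le, ← not_lt, he q (Finset.mem_union_right _
        (Finset.mem_image_of_mem Prod.snd hk')), ← Int.floor_lt, not_lt] at this
      refine mem_cutsAt.2 ⟨fun hq => ?_, fun hq => ?_⟩
      · exact fun hmem => by
          have h1 : 2 * (i : ℤ) + 1 ≤ ⌊q⌋ := this.1 hmem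
          have h2 : ⌊q⌋ = 2 * (i : ℤ) := hq
          omega
      · exact this.2 hq.ge)
  exact ⟨fun q y => w (q, y), fun r E hE s s' hs hs' => hw (Sum.inl ⟨r, ⟨E, hE⟩, ⟨s, hs⟩, ⟨s', hs'⟩⟩),
    fun i q => mem_cutsAt.1 (hw (Sum.inr (i, q)))⟩

/-- Each row is replaced by a row of its own block, so the cuts remain; the order remains too, and
with it indiscernibility over `B`. Ordinary Ramsey suffices for mutual indiscernibility: with the
block labels fixed, a colouring of rows is a colouring of increasing positions. -/
theorem exists_blockIndisc_cuts (hκ : ℵ₀ ≤ κ) (hU : IsSaturated L U κ) {B B' : Set U}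
    (hB : #B < κ) (hB' : #B' < κ) {α : Type x} [Finite α] (c : α → U) [Finite Y] {n : ℕ}
    {D : Fin n → Set (α ⊕ Y → U)} (hD : ∀ i, B.Definable L (D i)) {R : ℚ → Y → U}
    (hR : Indisc L B R) (hcut : Cuts D c R) :
    ∃ R : ℚ → Y → U, Indisc L B R ∧ BlockIndisc L B' R ∧ Cuts D c R := by
  classical
  let G : IndiscIndex L Y B ⊕ {k : IndiscIndex L Y B' // ∀ l, ⌊k.2.2.1.1 l⌋ = ⌊k.2.2.2.1 l⌋} ⊕
      (Fin n × ℚ) → Set (ℚ × Y → U) :=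
    Sum.elim (fun k => sameTruth k.2.1.1 k.2.2.1.1 k.2.2.2.1)
      (Sum.elim (fun k => sameTruth k.1.2.1.1 k.1.2.2.1.1 k.1.2.2.2.1)
        (fun k => {w | Sum.elim c w ∈ cutsAt k.1 (D k.1) k.2}))
  have hG : ∀ k, ((B ∪ B') ∪ range c).Definable L (G k) := by
    rintro (k | k | k)
    · exact (definable_sameTruth k.2.1.2 _ _).mono
        (subset_union_left.trans subset_union_left)
    · exact (definable_sameTruth k.1.2.1.2 _ _).mono
        (subset_union_right.trans subset_union_left)
    · exact definable_fiber c ((definable_cutsAt _ (hD k.1) _).mono subset_union_left)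
  have hBB : #(B ∪ B' : Set U) < κ := (mk_union_le _ _).trans_lt (add_lt_of_lt hκ hB hB')
  obtain ⟨w, hw⟩ := hU.exists_countable hκ (mk_union_range_lt hκ hBB c) hG (fun t => by
    obtain ⟨e, he⟩ := exists_rank (t.toLeft.biUnion IndiscIndex.rows ∪
      t.toRight.toLeft.biUnion fun k => k.1.rows)
    obtain ⟨H, hH, hhom⟩ := exists_strictMono_homogeneous_finset t.toRight.toLeft (fun k => k.1.1)
      (fun k q => (fun p => R (blockPoint ⌊k.1.2.2.1.1 p.1⌋ (q p.1)) p.2) ∈ k.1.2.1.1)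
    refine ⟨fun p => R (blockPoint ⌊p.1⌋ (H (e p.1))) p.2, ?_⟩
    have hmono : ∀ {r : ℕ} (s : Fin r → ℚ), StrictMono s → (∀ l l', s l < s l' → e (s l) < e (s l')) →
        StrictMono fun l => blockPoint ⌊s l⌋ (H (e (s l))) := fun s hs hes l l' hl =>
      blockPoint_lt_blockPoint (Int.floor_mono (hs hl).le) (hH (hes _ _ (hs hl)))
    rintro (k | k | ⟨i, q⟩) hk
    · have hk' : k ∈ t.toLeft := Finset.mem_toLeft.2 hk
      refine hR k.1 k.2.1.1 k.2.1.2 _ _ (hmono _ k.2.2.1.2 fun l l' hl => ?_)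
        (hmono _ k.2.2.2.2 fun l l' hl => ?_)
      · exact (he _ (Finset.mem_union_left _ (Finset.mem_biUnion.2
          ⟨k, hk', k.left_mem_rows l⟩)) _).2 hl
      · exact (he _ (Finset.mem_union_left _ (Finset.mem_biUnion.2
          ⟨k, hk', k.right_mem_rows l⟩)) _).2 hl
    · have hk' : k ∈ t.toRight.toLeft := Finset.mem_toLeft.2 (Finset.mem_toRight.2 hk)
      have := hhom k hk' (e ∘ k.1.2.2.1.1) (e ∘ k.1.2.2.2.1) (fun l l' hl =>
        (he _ (Finset.mem_union_right _ (Finset.mem_biUnion.2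
          ⟨k, hk', k.1.left_mem_rows l⟩)) _).2 (k.1.2.2.1.2 hl)) (fun l l' hl =>
        (he _ (Finset.mem_union_right _ (Finset.mem_biUnion.2
          ⟨k, hk', k.1.right_mem_rows l⟩)) _).2 (k.1.2.2.2.2 hl))
      refine this.trans ?_
      simp only [k.2]
      rfl
    · refine mem_cutsAt.2 ⟨fun hq => ?_, fun hq => ?_⟩
      · exact (hcut i (blockPoint ⌊q⌋ (H (e q)))).1 ((floor_blockPoint _ _).trans hq)
      · exact (hcut i (blockPoint ⌊q⌋ (H (e q)))).2 ((floor_blockPoint _ _).trans hq))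
  exact ⟨fun q y => w (q, y), fun r E hE s s' hs hs' => hw (Sum.inl ⟨r, ⟨E, hE⟩, ⟨s, hs⟩, ⟨s', hs'⟩⟩),
    fun r E hE s s' hs hs' hf => hw (Sum.inr (Sum.inl ⟨⟨r, ⟨E, hE⟩, ⟨s, hs⟩, ⟨s', hs'⟩⟩, hf⟩)),
    fun i q => mem_cutsAt.1 (hw (Sum.inr (Sum.inr (i, q))))⟩

end Extraction

/-! ### Moving rows while preserving truth. -/

section Merging

variable {L : FirstOrder.Language.{u, v}} {U : Type w} [L.Structure U] {Y : Type}

/-- A definable condition on the rows in `S` is a condition on finitely many of them. -/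
theorem exists_finite_rows {B : Set U} {E : Set (ℚ × Y → U)} (hE : B.Definable L E) {S : Set ℚ}
    (hS : ∀ w w' : ℚ × Y → U, (∀ q ∈ S, ∀ y, w (q, y) = w' (q, y)) → w ∈ E → w' ∈ E) :
    ∃ (r : ℕ) (E' : Set (Fin r × Y → U)) (s : Fin r → ℚ), B.Definable L E' ∧ StrictMono s ∧
      (∀ l, s l ∈ S) ∧
      ∀ g : ℚ → Y → U, (fun p => g p.1 p.2) ∈ E ↔ (fun p => g (s p.1) p.2) ∈ E' := by
  classical
  obtain ⟨F₀, hF₀⟩ := hE.exists_finset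
  let F := (F₀.image Prod.fst).filter (· ∈ S)
  have hagree : ∀ w w' : ℚ × Y → U, (∀ q ∈ F, ∀ y, w (q, y) = w' (q, y)) → w ∈ E → w' ∈ E := by
    intro w w' hw hwE
    -- Rows outside `S` are irrelevant to `E`, so they may first be overwritten by those of `w'`.
    refine hF₀ (fun p => if p.1 ∈ S then w p else w' p) w' (fun p hp => ?_)
      (hS w _ (fun q hq y => by simp [hq]) hwE)
    by_cases hpS : p.1 ∈ S
    · simpa [hpS] using hw p.1 (Finset.mem_filter.2 ⟨Finset.mem_image_of_mem _ hp, hpS⟩) p.2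
    · simp [hpS]
  have hs : ∀ l, F.orderEmbOfFin rfl l ∈ F := F.orderEmbOfFin_mem rfl
  rcases F.eq_empty_or_nonempty with hF | ⟨q₀, hq₀⟩
  · refine ⟨F.card, {_z | E.Nonempty}, F.orderEmbOfFin rfl, definable_const _,
      (F.orderEmbOfFin rfl).strictMono, fun l => (Finset.mem_filter.1 (hs l)).2, fun g => ?_⟩
    refine ⟨fun h => ⟨_, h⟩, ?_⟩
    rintro ⟨w, hw⟩
    exact hagree w _ (by simp [hF]) hw
  · have hidx : ∀ q ∈ F, ∃ l, F.orderEmbOfFin rfl l = q := fun q hq => by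
      have : q ∈ Set.range (F.orderEmbOfFin rfl) := by simpa using hq
      exact this
    have : Nonempty (Fin F.card) := ⟨⟨0, Finset.card_pos.2 ⟨q₀, hq₀⟩⟩⟩
    choose! idx hidx using hidx
    refine ⟨F.card, _, F.orderEmbOfFin rfl,
      hE.preimage_comp (fun p : ℚ × Y => (idx p.1, p.2)),
      (F.orderEmbOfFin rfl).strictMono, fun l => (Finset.mem_filter.1 (hs l)).2, fun g => ?_⟩
    exact ⟨hagree _ _ (fun q hq y => by simp [hidx q hq]),
      hagree _ _ (fun q hq y => by simp [hidx q hq])⟩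

theorem Indisc.mem_iff {B : Set U} {R : ℚ → Y → U} (hR : Indisc L B R) {E : Set (ℚ × Y → U)}
    (hE : B.Definable L E) {S : Set ℚ}
    (hS : ∀ w w' : ℚ × Y → U, (∀ q ∈ S, ∀ y, w (q, y) = w' (q, y)) → w ∈ E → w' ∈ E)
    {h : ℚ → ℚ} (hh : StrictMonoOn h S) :
    (fun p => R p.1 p.2) ∈ E ↔ (fun p => R (h p.1) p.2) ∈ E := by
  obtain ⟨r, E', s, hE', hs, hsS, hg⟩ := exists_finite_rows hE hS
  rw [hg R, hg fun q => R (h q)]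
  exact hR r E' hE' s (h ∘ s) hs fun l l' hl => hh (hsS l) (hsS l') (hs hl)

/-- Moving a single row from the block at `p` to the block at `p + 1` preserves truth. -/
def MergeStep (L : FirstOrder.Language.{u, v}) {U : Type w} [L.Structure U] {Y : Type} (B : Set U)
    (R : ℚ → Y → U) (p : ℤ) : Prop :=
  ∀ (r : ℕ) (E : Set (Fin r × Y → U)), B.Definable L E → ∀ (s s' : Fin r → ℚ) (l : Fin r),
    StrictMono s → StrictMono s' → ⌊s l⌋ = p → ⌊s' l⌋ = p + 1 →
    (∀ l' ≠ l, ⌊s l'⌋ = ⌊s' l'⌋) →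
      ((fun p => R (s p.1) p.2) ∈ E ↔ (fun p => R (s' p.1) p.2) ∈ E)

/-- Induction on the number of entries that change block, one `MergeStep` at a time. -/
theorem BlockIndisc.iff_of_mergeStep {B : Set U} {R : ℚ → Y → U} (hR : BlockIndisc L B R) {r : ℕ}
    {E : Set (Fin r × Y → U)} (hE : B.Definable L E) {s s' : Fin r → ℚ} (hs : StrictMono s)
    (hs' : StrictMono s')
    (h : ∀ l, ⌊s' l⌋ = ⌊s l⌋ ∨ MergeStep L B R ⌊s l⌋ ∧ ⌊s' l⌋ = ⌊s l⌋ + 1) :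
    (fun p => R (s p.1) p.2) ∈ E ↔ (fun p => R (s' p.1) p.2) ∈ E := by
  classical
  induction hN : (Finset.univ.filter fun l => ⌊s' l⌋ ≠ ⌊s l⌋).card generalizing s with
  | zero =>
    refine hR r E hE s s' hs hs' fun l => ?_
    by_contra hl
    exact Finset.notMem_empty l (Finset.card_eq_zero.1 hN ▸
      Finset.mem_filter.2 ⟨Finset.mem_univ l, fun h => hl h.symm⟩)
  | succ N ih =>
    set W := Finset.univ.filter fun l => ⌊s' l⌋ ≠ ⌊s l⌋ with hW
    have hne : W.Nonempty := Finset.card_pos.1 (by omega)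
    -- Moving the last such entry first keeps the block labels monotone: all later entries already
    -- have their final label.
    let l := W.max' hne
    have hl : ⌊s' l⌋ ≠ ⌊s l⌋ := (Finset.mem_filter.1 (W.max'_mem hne)).2
    obtain ⟨hstep, hl'⟩ := (h l).resolve_left hl
    let lab : Fin r → ℤ := fun l' => if l' = l then ⌊s' l⌋ else ⌊s l'⌋
    have hlab : Monotone lab := by
      intro l₁ l₂ h12
      simp only [lab]
      split_ifs with h1 h2 h2
      · exact le_rfl
      · have hlt : l < l₂ := lt_of_le_of_ne (h1 ▸ h12) (Ne.symm h2)
        have : ⌊s' l₂⌋ = ⌊s l₂⌋ := by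
          by_contra hc
          exact absurd (W.le_max' l₂ (Finset.mem_filter.2 ⟨Finset.mem_univ _, hc⟩)) (not_le.2 hlt)
        rw [← this]
        exact Int.floor_mono (hs' hlt).le
      · rw [hl']
        exact (Int.floor_mono (hs.monotone (h2 ▸ h12))).trans (by omega)
      · exact Int.floor_mono (hs.monotone h12)
    let s₁ : Fin r → ℚ := fun l' => blockPoint (lab l') l'
    have hs₁ : StrictMono s₁ := fun l₁ l₂ h12 => blockPoint_lt_blockPoint (hlab h12.le) h12
    have hfl : ∀ l', ⌊s₁ l'⌋ = lab l' := fun l' => floor_blockPoint _ _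
    have hlabl : lab l = ⌊s' l⌋ := by simp [lab]
    have hlabne : ∀ l' ≠ l, lab l' = ⌊s l'⌋ := fun l' h => by simp [lab, h]
    refine (hstep r E hE s s₁ l hs hs₁ rfl (by rw [hfl, hlabl, hl'])
      (fun l' h => by rw [hfl, hlabne l' h])).trans (ih hs₁ (fun l' => ?_) ?_)
    · rw [hfl]
      by_cases hll : l' = l
      · subst hll
        exact Or.inl hlabl.symm
      · rw [hlabne l' hll]
        exact h l'
    · have : (Finset.univ.filter fun l' => ⌊s' l'⌋ ≠ ⌊s₁ l'⌋) = W.erase l := by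
        ext l'
        simp only [Finset.mem_filter, Finset.mem_univ, true_and, Finset.mem_erase, hW, hfl]
        by_cases hll : l' = l
        · subst hll
          simp [hlabl]
        · simp [hlabne l' hll, hll]
      rw [this, Finset.card_erase_of_mem (W.max'_mem hne), hN]
      rfl

theorem BlockIndisc.mem_iff {B : Set U} {R : ℚ → Y → U} (hR : BlockIndisc L B R)
    {E : Set (ℚ × Y → U)} (hE : B.Definable L E) {S : Set ℚ}
    (hS : ∀ w w' : ℚ × Y → U, (∀ q ∈ S, ∀ y, w (q, y) = w' (q, y)) → w ∈ E → w' ∈ E)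
    {h : ℚ → ℚ} (hh : StrictMonoOn h S)
    (hstep : ∀ q ∈ S, ⌊h q⌋ = ⌊q⌋ ∨ MergeStep L B R ⌊q⌋ ∧ ⌊h q⌋ = ⌊q⌋ + 1) :
    (fun p => R p.1 p.2) ∈ E ↔ (fun p => R (h p.1) p.2) ∈ E := by
  obtain ⟨r, E', s, hE', hs, hsS, hg⟩ := exists_finite_rows hE hS
  rw [hg R, hg fun q => R (h q)]
  exact hR.iff_of_mergeStep hE' hs (s' := h ∘ s) (fun l l' hl => hh (hsS l) (hsS l') (hs hl))
    fun l => hstep _ (hsS l)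

/-- This is the property of rows that gets transported: it mentions no fixed tuple, only the
existence of one in `C` with prescribed cuts. -/
theorem definable_exists_pattern {A : Set U} {α ι J : Type*} [Finite J] {C : Set (α → U)}
    (hC : A.Definable L C) {P : J → Set (α ⊕ ι → U)} (hP : ∀ j, A.Definable L (P j))
    (v : J → Prop) :
    A.Definable L {w : ι → U | ∃ c' ∈ C, ∀ j, (Sum.elim c' w ∈ P j ↔ v j)} := by
  have h1 := hC.preimage_comp (Sum.inr : α → ι ⊕ α)
  have h2 := definable_iInter_of_finite fun j =>
    ((hP j).preimage_comp (Sum.swap : α ⊕ ι → ι ⊕ α)).iff (definable_const (v j))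
  convert definable_exists (h1.inter h2) using 1
  ext w
  simp only [mem_ofPred_eq, mem_inter_iff, mem_preimage, mem_iInter]
  refine exists_congr fun c' => and_congr Iff.rfl (forall_congr' fun j => ?_)
  have : (Sum.elim w c' ∘ Sum.swap : α ⊕ ι → U) = Sum.elim c' w := by ext (i | i) <;> rfl
  rw [this]

end Merging

/-! ### Mergeable blocks give a pattern for the second tuple. -/

section Splitting

variable {L : FirstOrder.Language.{u, v}} {U : Type w} [L.Structure U] {Y : Type} [Finite Y]

theorem two_mul_injective {n : ℕ} (T : Finset (Fin n)) :
    Function.Injective fun i : T => 2 * ((i : Fin n) : ℤ) := fun i i' h => by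
  have h : 2 * ((i : Fin n) : ℤ) = 2 * ((i' : Fin n) : ℤ) := h
  exact Subtype.ext (Fin.ext (by omega))

/-- If the blocks at `2 i` and `2 i + 1` can be merged over `B` for `i ∈ T`, then a tuple `c` that
cuts these sequences gives rise to an IRD-pattern over `B`. -/
theorem card_mem_irdDepths_of_mergeStep {B : Set U} {α : Type x} {c : α → U} {n : ℕ}
    {D : Fin n → Set (α ⊕ Y → U)} (hD : ∀ i, B.Definable L (D i)) {R : ℚ → Y → U}
    (hR : BlockIndisc L B R) (hcut : Cuts D c R) (T : Finset (Fin n))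
    (hT : ∀ i ∈ T, MergeStep L B R (2 * (i : ℤ))) : T.card ∈ irdDepths (tp L c B) := by
  classical
  rw [← Fintype.card_coe]
  refine card_mem_irdDepths (A := fun _ => B) (D := fun i : T => D i) (fun i => hD i)
    (fun i j => R (blockPoint (2 * ((i : Fin n) : ℤ)) j)) (fun C hC hc f N => ?_)
  let F : ℤ → ℕ := Function.extend (fun i : T => 2 * ((i : Fin n) : ℤ)) f 0
  have hF : ∀ i : T, F (2 * ((i : Fin n) : ℤ)) = f i := fun i =>
    (two_mul_injective T).extend_apply f 0 i
  -- Rows of block 2i from position `f i` on move to block 2i+1. On the moved rows `c` itself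
  -- realizes the cut at `f i`, so on the original rows some `c'` in `C` does.
  let h : ℚ → ℚ := fun q => if blockPoint ⌊q⌋ (F ⌊q⌋) ≤ q then q + 1 else q
  have hle : ∀ q, q ≤ h q := fun q => by
    simp only [h]
    split_ifs <;> linarith
  -- Odd blocks are left out, which makes room for the moved rows.
  let S : Set ℚ := {q | ∃ i : T, ⌊q⌋ = 2 * ((i : Fin n) : ℤ)}
  have hh : StrictMonoOn h S := by
    rintro q ⟨i, hi⟩ q' ⟨i', hi'⟩ hqq
    refine lt_of_lt_of_le ?_ (le_refl (h q'))
    by_cases hq : blockPoint ⌊q⌋ (F ⌊q⌋) ≤ q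
    · have e : h q = q + 1 := if_pos hq
      rcases (Int.floor_mono hqq.le).eq_or_lt with hfl | hfl
      · have e' : h q' = q' + 1 := if_pos (hfl ▸ hq.trans hqq.le)
        linarith
      · have h2 : ⌊q⌋ + 2 ≤ ⌊q'⌋ := by omega
        have h2' : (⌊q⌋ : ℚ) + 2 ≤ ⌊q'⌋ := by exact_mod_cast h2
        linarith [hle q', Int.floor_le q', Int.lt_floor_add_one q]
    · have e : h q = q := if_neg hq
      linarith [hle q']
  have hval : ∀ (i : T) (j : ℕ), h (blockPoint (2 * ((i : Fin n) : ℤ)) j) =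
      if f i ≤ j then blockPoint (2 * ((i : Fin n) : ℤ)) j + 1
      else blockPoint (2 * ((i : Fin n) : ℤ)) j := fun i j => by
    simp only [h, floor_blockPoint, hF, (blockPoint_strictMono _).le_iff_le]
  let P : T × Fin N → Set (α ⊕ (ℚ × Y) → U) := fun p =>
    (fun z => z ∘ Sum.map id (Prod.mk (blockPoint (2 * ((p.1 : Fin n) : ℤ)) p.2))) ⁻¹' D p.1
  have hPmem : ∀ (p : T × Fin N) (c' : α → U) (g : ℚ × Y → U), Sum.elim c' g ∈ P p ↔
      Sum.elim c' (fun y => g (blockPoint (2 * ((p.1 : Fin n) : ℤ)) p.2, y)) ∈ D p.1 := by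
    intro p c' g
    have : (Sum.elim c' g ∘ Sum.map id (Prod.mk (blockPoint (2 * ((p.1 : Fin n) : ℤ)) p.2)) :
        α ⊕ Y → U) =
        Sum.elim c' (fun y => g (blockPoint (2 * ((p.1 : Fin n) : ℤ)) p.2, y)) := by
      ext (l | l) <;> rfl
    simp only [P, mem_preimage, this]
  have hE := definable_exists_pattern hC (P := P) (fun p => (hD p.1).preimage_comp _)
    (fun p => f p.1 ≤ p.2)
  have key := (hR.mem_iff hE (S := S) (h := h) (fun w w' hww => ?_) hh (fun q hq => ?_)).2
    ⟨c, hc, fun p => ?_⟩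
  · obtain ⟨c', hc', hp⟩ := key
    exact ⟨c', hc', fun i j hj => (hPmem (i, ⟨j, hj⟩) c' _).symm.trans (hp (i, ⟨j, hj⟩))⟩
  · rintro ⟨c', hc', hp⟩
    refine ⟨c', hc', fun p => ?_⟩
    rw [← hp p, hPmem, hPmem]
    have : ∀ y, w (blockPoint (2 * ((p.1 : Fin n) : ℤ)) p.2, y) =
        w' (blockPoint (2 * ((p.1 : Fin n) : ℤ)) p.2, y) := fun y =>
      hww _ ⟨p.1, floor_blockPoint _ _⟩ y
    simp only [this]
  · obtain ⟨i, hi⟩ := hq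
    simp only [h]
    split_ifs
    · exact Or.inr ⟨hi ▸ hT i i.2, by simp⟩
    · exact Or.inl rfl
  · rw [hPmem]
    simp only [hval]
    split_ifs with hp
    · refine ⟨fun _ => hp, fun _ => (hcut p.1 _).2 ?_⟩
      rw [Int.floor_add_one, floor_blockPoint]
    · exact ⟨fun hm => absurd hm ((hcut p.1 _).1 (floor_blockPoint _ _)), fun hp' => absurd hp' hp⟩

end Splitting

/-! ### Unmergeable blocks give a pattern for the first tuple. -/

section Splitting

variable {L : FirstOrder.Language.{u, v}} {U : Type w} [L.Structure U] {Y : Type} [Finite Y]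

/-- The `t`-th term of an increasing sequence in the upper half `[p + 1 / 2, p + 1)` of a block. -/
def upperPoint (p : ℤ) (t : ℕ) : ℚ := p + 1 / 2 + blockPoint 0 t / 2

theorem le_upperPoint (p : ℤ) (t : ℕ) : (p : ℚ) + 1 / 2 ≤ upperPoint p t := by
  have := le_blockPoint 0 t
  push_cast at this
  unfold upperPoint
  linarith

theorem upperPoint_lt (p : ℤ) (t : ℕ) : upperPoint p t < p + 1 := by
  have := blockPoint_lt 0 t
  push_cast at this
  unfold upperPoint
  linarith

theorem floor_upperPoint (p : ℤ) (t : ℕ) : ⌊upperPoint p t⌋ = p :=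
  Int.floor_eq_iff.2 ⟨by linarith [le_upperPoint p t], upperPoint_lt p t⟩

theorem upperPoint_strictMono (p : ℤ) : StrictMono (upperPoint p) := fun t t' h => by
  have := blockPoint_strictMono 0 h
  unfold upperPoint
  linarith

/-- Points in the lower halves of the even blocks and the upper halves of the odd blocks. -/
def outerPoint (p : ℤ) (t : ℕ) : ℚ := if Even p then upperPoint p t - 1 / 2 else upperPoint p t

theorem floor_outerPoint (p : ℤ) (t : ℕ) : ⌊outerPoint p t⌋ = p := by
  unfold outerPoint
  split_ifs
  · exact Int.floor_eq_iff.2 ⟨by linarith [le_upperPoint p t], by linarith [upperPoint_lt p t]⟩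
  · exact floor_upperPoint p t

theorem outerPoint_lt_outerPoint {p p' : ℤ} {t t' : ℕ} (hp : p ≤ p') (ht : t < t') :
    outerPoint p t < outerPoint p' t' := by
  rcases hp.eq_or_lt with rfl | hp
  · have := upperPoint_strictMono p ht
    unfold outerPoint
    split_ifs <;> linarith
  · have h1 : (p : ℚ) + 1 ≤ p' := by exact_mod_cast hp
    have h2 := Int.lt_floor_add_one (outerPoint p t)
    have h3 := Int.floor_le (outerPoint p' t')
    rw [floor_outerPoint] at h2 h3
    linarith

theorem outerPoint_lt_of_le {p p' : ℤ} (hp' : Even p') (h : p ≤ p') (t : ℕ) :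
    outerPoint p t < p' + 1 / 2 := by
  rcases h.eq_or_lt with rfl | h
  · rw [outerPoint, if_pos hp']
    linarith [upperPoint_lt p t]
  · have h1 : (p : ℚ) + 1 ≤ p' := by exact_mod_cast h
    have h2 := Int.lt_floor_add_one (outerPoint p t)
    rw [floor_outerPoint] at h2
    linarith

theorem le_outerPoint_of_lt {p p' : ℤ} (hp' : Even p') (h : p' < p) (t : ℕ) :
    (p' : ℚ) + 3 / 2 ≤ outerPoint p t := by
  rcases (Int.add_one_le_iff.2 h).eq_or_lt with rfl | h
  · have h0 : ¬ Even (p' + 1) := by simpa [Int.even_add_one] using hp'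
    rw [outerPoint, if_neg h0]
    have := le_upperPoint (p' + 1) t
    push_cast at this
    linarith
  · have h1 : (p' : ℚ) + 1 + 1 ≤ p := by exact_mod_cast h
    have h3 := Int.floor_le (outerPoint p t)
    rw [floor_outerPoint] at h3
    linarith

/-- If the blocks at `2 i` and `2 i + 1` cannot be merged over `B ∪ range a` for `i ∈ T`, then `a`
gives rise to an IRD-pattern over `B`. -/
theorem card_mem_irdDepths_of_not_mergeStep {B : Set U} {α : Type x} [Finite α] {a : α → U} {n : ℕ}
    {R : ℚ → Y → U} (hR : Indisc L B R) (hR' : BlockIndisc L (B ∪ range a) R) (T : Finset (Fin n))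
    (hT : ∀ i ∈ T, ¬ MergeStep L (B ∪ range a) R (2 * (i : ℤ))) :
    T.card ∈ irdDepths (tp L a B) := by
  classical
  -- Failure of merging gives a formula over `B ∪ range a` and an entry `l` whose change of block
  -- alters its truth. By block indiscernibility, with the other labels fixed, the truth of `G` at
  -- `a` depends only on the block of row `l`; `v` is its value for block 2i+1.
  have hT' : ∀ i : T, ∃ (r : ℕ) (G : Set (α ⊕ Fin r × Y → U)) (s s' : Fin r → ℚ) (l : Fin r),
      B.Definable L G ∧ StrictMono s ∧ StrictMono s' ∧ ⌊s l⌋ = 2 * ((i : Fin n) : ℤ) ∧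
      ⌊s' l⌋ = 2 * ((i : Fin n) : ℤ) + 1 ∧ (∀ l' ≠ l, ⌊s l'⌋ = ⌊s' l'⌋) ∧
      ∃ v : Prop, ∀ g : Fin r → ℚ, StrictMono g → (∀ l' ≠ l, ⌊g l'⌋ = ⌊s l'⌋) →
        (⌊g l⌋ = 2 * ((i : Fin n) : ℤ) →
          ¬ (Sum.elim a (fun p => R (g p.1) p.2) ∈ G ↔ v)) ∧
        (⌊g l⌋ = 2 * ((i : Fin n) : ℤ) + 1 → (Sum.elim a (fun p => R (g p.1) p.2) ∈ G ↔ v)) := by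
    rintro ⟨i, hi⟩
    have := hT i hi
    simp only [MergeStep] at this
    push Not at this
    obtain ⟨r, E, hE, s, s', l, hs, hs', hl, hl', hll, hne⟩ := this
    obtain ⟨G, hG, hGE⟩ := exists_definable_fiber hE
    have hne' : ¬ ((fun p => R (s p.1) p.2) ∈ E ↔ (fun p => R (s' p.1) p.2) ∈ E) := by tauto
    refine ⟨r, G, s, s', l, hG, hs, hs', hl, hl', hll, (fun p => R (s' p.1) p.2) ∈ E,
      fun g hg hgl => ⟨fun h => ?_, fun h => ?_⟩⟩
    · rw [← hGE]
      rwa [hR' r E hE g s hg hs fun l' => ?_]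
      by_cases h' : l' = l
      · subst h'
        rw [h, hl]
      · exact hgl l' h'
    · rw [← hGE]
      refine hR' r E hE g s' hg hs' fun l' => ?_
      by_cases h' : l' = l
      · subst h'
        rw [h, hl']
      · rw [hgl l' h', hll l' h']
  choose r G s s' l hG hs hs' hl hl' hll v hv using hT'
  -- Row `l` runs through the window [2i+1/2, 2i+3/2), and all other rows sit at outer points, which
  -- avoid the windows. The labels of `s` place earlier entries below the window; those of `s'`
  -- place later ones above it.
  let g : ∀ i : T, ℚ → Fin (r i) → ℚ := fun i z l' =>
    if l' = l i then z else outerPoint ⌊s i l'⌋ l'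
  have hgl : ∀ i z, g i z (l i) = z := fun i z => by simp [g]
  have hgne : ∀ i z, ∀ l' ≠ l i, g i z l' = outerPoint ⌊s i l'⌋ l' := fun i z l' h' => by
    simp [g, h']
  have hgmono : ∀ (i : T) (z : ℚ), ((2 * ((i : Fin n) : ℤ) : ℤ) : ℚ) + 1 / 2 ≤ z →
      z < ((2 * ((i : Fin n) : ℤ) : ℤ) : ℚ) + 3 / 2 → StrictMono (g i z) := by
    intro i z hz hz' l₁ l₂ h12
    by_cases h1 : l₁ = l i
    · have h2 : l₂ ≠ l i := fun h => by rw [h1, h] at h12; exact lt_irrefl _ h12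
      rw [h1, hgl, hgne i z l₂ h2]
      refine hz'.trans_le (le_outerPoint_of_lt (by simp) ?_ _)
      have := Int.floor_mono (hs' i h12).le
      rw [h1, hl' i] at this
      rw [hll i l₂ h2]
      omega
    · rw [hgne i z l₁ h1]
      by_cases h2 : l₂ = l i
      · rw [h2, hgl]
        refine (outerPoint_lt_of_le (by simp) ?_ _).trans_le hz
        have := Int.floor_mono (hs i h12).le
        rwa [h2, hl i] at this
      · rw [hgne i z l₂ h2]
        exact outerPoint_lt_outerPoint (Int.floor_mono (hs i h12).le) h12
  rw [← Fintype.card_coe]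
  let ρ : ∀ i : T, α ⊕ Fin (r i) × Y → (Fin (r i) × Y) ⊕ (α ⊕ Y) := fun i =>
    Sum.elim (fun m => Sum.inr (Sum.inl m))
      (fun p => if p.1 = l i then Sum.inr (Sum.inr p.2) else Sum.inl p)
  let par : ∀ i : T, Fin (r i) × Y → U := fun i p => R (outerPoint ⌊s i p.1⌋ p.1) p.2
  have hD : ∀ i : T, (B ∪ range (par i)).Definable L
      {z : α ⊕ Y → U | Sum.elim (par i) z ∈
        {z | z ∈ (fun z => z ∘ ρ i) ⁻¹' G i ↔ z ∈ {_z : (Fin (r i) × Y) ⊕ (α ⊕ Y) → U | v i}}} :=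
    fun i => definable_fiber (par i) (((hG i).preimage_comp (ρ i)).iff (definable_const (v i)))
  refine card_mem_irdDepths hD
    (fun i j => R (upperPoint (2 * ((i : Fin n) : ℤ)) j)) (fun C hC hc f N => ?_)
  have hDmem : ∀ (i : T) (c' : α → U) (z : ℚ), Sum.elim c' (R z) ∈
      {z : α ⊕ Y → U | Sum.elim (par i) z ∈
        {z | z ∈ (fun z => z ∘ ρ i) ⁻¹' G i ↔ z ∈ {_z : (Fin (r i) × Y) ⊕ (α ⊕ Y) → U | v i}}} ↔
      (Sum.elim c' (fun p => R (g i z p.1) p.2) ∈ G i ↔ v i) := by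
    intro i c' z
    have : (Sum.elim (par i) (Sum.elim c' (R z)) ∘ ρ i : α ⊕ Fin (r i) × Y → U) =
        Sum.elim c' (fun p => R (g i z p.1) p.2) := by
      ext (m | ⟨l', y⟩)
      · rfl
      · by_cases h' : l' = l i
        · simp [ρ, g, h']
        · simp [ρ, g, h', par]
    simp only [mem_ofPred_eq, mem_preimage, this]
  let F : ℤ → ℕ := Function.extend (fun i : T => 2 * ((i : Fin n) : ℤ)) f 0
  have hF : ∀ i : T, F (2 * ((i : Fin n) : ℤ)) = f i := fun i =>
    (two_mul_injective T).extend_apply f 0 i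
  -- The rows past the desired cut move by 1/2, from the upper half of block 2i to the lower half of
  -- block 2i+1. Outer points stay fixed, so the auxiliary parameters do not change.
  let h : ℚ → ℚ := fun q => if Even ⌊q⌋ ∧ upperPoint ⌊q⌋ (F ⌊q⌋) ≤ q then q + 1 / 2 else q
  have hle : ∀ q, q ≤ h q := fun q => by
    simp only [h]
    split_ifs <;> linarith
  -- Leaving out the lower halves of odd blocks makes room for the shift.
  let S : Set ℚ := {q | ¬ Even ⌊q⌋ → (⌊q⌋ : ℚ) + 1 / 2 ≤ q}
  have hh : StrictMonoOn h S := by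
    intro q hq q' hq' hqq
    by_cases hqh : Even ⌊q⌋ ∧ upperPoint ⌊q⌋ (F ⌊q⌋) ≤ q
    · have e : h q = q + 1 / 2 := if_pos hqh
      have hlt := Int.lt_floor_add_one q
      rcases (Int.floor_mono hqq.le).eq_or_lt with hfl | hfl
      · have e' : h q' = q' + 1 / 2 := if_pos (hfl ▸ ⟨hqh.1, hqh.2.trans hqq.le⟩)
        linarith
      · rcases (Int.add_one_le_iff.2 hfl).eq_or_lt with hfl' | hfl'
        · have hodd : ¬ Even ⌊q'⌋ := by
            rw [← hfl']
            simpa [Int.even_add_one] using hqh.1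
          have h1 := hq' hodd
          rw [← hfl'] at h1
          push_cast at h1
          linarith [hle q']
        · have h2 : (⌊q⌋ : ℚ) + 1 + 1 ≤ ⌊q'⌋ := by exact_mod_cast hfl'
          linarith [hle q', Int.floor_le q']
    · have e : h q = q := if_neg hqh
      linarith [hle q']
  have houter : ∀ p t, h (outerPoint p t) = outerPoint p t := fun p t => by
    refine if_neg ?_
    rw [floor_outerPoint]
    rintro ⟨h1, h2⟩
    linarith [outerPoint_lt_of_le h1 le_rfl t, le_upperPoint p (F p)]
  have hupper : ∀ (i : T) (j : ℕ), h (upperPoint (2 * ((i : Fin n) : ℤ)) j) =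
      if f i ≤ j then upperPoint (2 * ((i : Fin n) : ℤ)) j + 1 / 2
      else upperPoint (2 * ((i : Fin n) : ℤ)) j := fun i j => by
    simp only [h, floor_upperPoint, hF, (upperPoint_strictMono _).le_iff_le]
    simp
  have houterS : ∀ p t, outerPoint p t ∈ S := fun p t hp => by
    rw [floor_outerPoint] at hp ⊢
    rw [outerPoint, if_neg hp]
    exact le_upperPoint p t
  have hupperS : ∀ (i : T) (j : ℕ), upperPoint (2 * ((i : Fin n) : ℤ)) j ∈ S := fun i j hp => by
    rw [floor_upperPoint]
    exact le_upperPoint _ j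
  have hgS : ∀ (i : T) (j : ℕ) (l' : Fin (r i)),
      g i (upperPoint (2 * ((i : Fin n) : ℤ)) j) l' ∈ S := fun i j l' => by
    by_cases h' : l' = l i
    · rw [h', hgl]
      exact hupperS i j
    · rw [hgne _ _ _ h']
      exact houterS _ _
  have hgh : ∀ (i : T) (z : ℚ) (l' : Fin (r i)), h (g i z l') = g i (h z) l' := fun i z l' => by
    by_cases h' : l' = l i
    · rw [h', hgl, hgl]
    · rw [hgne _ _ _ h', hgne _ _ _ h', houter]
  let τ : ∀ p : T × Fin N, Fin (r p.1) × Y → ℚ × Y := fun p k =>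
    (g p.1 (upperPoint (2 * ((p.1 : Fin n) : ℤ)) p.2) k.1, k.2)
  let P : T × Fin N → Set (α ⊕ (ℚ × Y) → U) := fun p =>
    {z | z ∈ (fun z => z ∘ Sum.map id (τ p)) ⁻¹' G p.1 ↔ z ∈ {_z : α ⊕ (ℚ × Y) → U | v p.1}}
  have hPmem : ∀ (p : T × Fin N) (c' : α → U) (w : ℚ × Y → U), Sum.elim c' w ∈ P p ↔
      (Sum.elim c' (fun k => w (τ p k)) ∈ G p.1 ↔ v p.1) := by
    intro p c' w
    have : (Sum.elim c' w ∘ Sum.map id (τ p) : α ⊕ Fin (r p.1) × Y → U) =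
        Sum.elim c' (fun k => w (τ p k)) := by
      ext (m | k) <;> rfl
    simp only [P, mem_ofPred_eq, mem_preimage, this]
  have hE := definable_exists_pattern hC (P := P)
    (fun p => ((hG p.1).preimage_comp _).iff (definable_const _)) (fun p => f p.1 ≤ p.2)
  have key := (hR.mem_iff hE (S := S) (h := h) (fun w w' hww => ?_) hh).2 ⟨a, hc, fun p => ?_⟩
  · obtain ⟨c', hc', hp⟩ := key
    refine ⟨c', hc', fun i j hj => ?_⟩
    rw [hDmem]
    exact (hPmem (i, ⟨j, hj⟩) c' _).symm.trans (hp (i, ⟨j, hj⟩))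
  · rintro ⟨c', hc', hp⟩
    refine ⟨c', hc', fun p => ?_⟩
    rw [← hp p, hPmem, hPmem]
    have : ∀ k, w (τ p k) = w' (τ p k) := fun k => hww _ (hgS _ _ _) _
    simp only [this]
  · rw [hPmem]
    simp only [τ, hgh, hupper]
    have h1 := le_upperPoint (2 * ((p.1 : Fin n) : ℤ)) p.2
    have h2 := upperPoint_lt (2 * ((p.1 : Fin n) : ℤ)) p.2
    split_ifs with hp
    · refine ⟨fun _ => hp, fun _ => ?_⟩
      refine (hv p.1 (g p.1 _) (hgmono _ _ (by linarith) (by linarith)) fun l' h' => ?_).2 ?_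
      · rw [hgne _ _ _ h', floor_outerPoint]
      · rw [hgl]
        refine Int.floor_eq_iff.2 ⟨?_, ?_⟩ <;> push_cast at h1 h2 ⊢ <;> linarith
    · refine ⟨fun hm => absurd hm ?_, fun hp' => absurd hp' hp⟩
      refine (hv p.1 (g p.1 _) (hgmono _ _ (by linarith) (by linarith)) fun l' h' => ?_).1 ?_
      · rw [hgne _ _ _ h', floor_outerPoint]
      · rw [hgl, floor_upperPoint]

variable {κ : Cardinal.{w}}

/-- The indices where merging over `A ∪ range a` succeeds are charged to `b`, the others to `a`. -/
theorem exists_add_of_mem_irdDepths (hκ : ℵ₀ ≤ κ) (hU : IsSaturated L U κ) {A : Set U}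
    (hA : #A < κ) {α β : Type*} [Finite α] [Finite β] (a : α → U) (b : β → U) {n : ℕ}
    (h : n ∈ irdDepths (tp L (Sum.elim a b) A)) :
    ∃ n₁ ∈ irdDepths (tp L a A), ∃ n₂ ∈ irdDepths (tp L b (A ∪ range a)), n = n₁ + n₂ := by
  classical
  obtain ⟨Y, _, D, R, hD, hR⟩ := exists_rows_of_mem_irdDepths h
  have hDA : ∀ i, A.Definable L (D i) := fun i => (hD i).mono (empty_subset _)
  obtain ⟨R, hR, hcut⟩ := exists_indisc_cuts hκ hU hA (Sum.elim a b) hDA R hR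
  obtain ⟨R, hR, hR', hcut⟩ := exists_blockIndisc_cuts hκ hU hA (mk_union_range_lt hκ hA a)
    (Sum.elim a b) hDA hR hcut
  let T : Finset (Fin n) :=
    Finset.univ.filter fun i => MergeStep L (A ∪ range a) R (2 * (i : ℤ))
  refine ⟨_, card_mem_irdDepths_of_not_mergeStep hR hR' Tᶜ (fun i hi => ?_), _,
    card_mem_irdDepths_of_mergeStep (c := b)
      (D := fun i => {z : β ⊕ Y → U | Sum.elim a z ∈
        (fun z => z ∘ (Equiv.sumAssoc α β Y)) ⁻¹' D i})
      (fun i => definable_fiber a ((hDA i).preimage_comp _)) hR' (fun i q => ?_) T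
      (fun i hi => (Finset.mem_filter.1 hi).2), ?_⟩
  · simpa [T] using hi
  · have : (Sum.elim a (Sum.elim b (R q)) ∘ Equiv.sumAssoc α β Y : (α ⊕ β) ⊕ Y → U) =
        Sum.elim (Sum.elim a b) (R q) := by
      ext ((l | l) | l) <;> rfl
    simp only [mem_ofPred_eq, mem_preimage, this]
    exact hcut i q
  · rw [Finset.card_compl, Fintype.card_fin]
    have := T.card_le_univ
    rw [Fintype.card_fin] at this
    omega

end Splitting

/-! ### From a pattern of depth 1 to infinite op-ranks. -/

section OpRankOfPattern

variable {L : FirstOrder.Language.{u, v}} {U : Type w} [L.Structure U] {α : Type x}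

theorem opRankInfinite_of_split {n : ℕ} {Δ : Finset (PartitionedFormula L U α)}
    (P : PartialType L U α → Prop) (hP : ∀ Q, P Q → Consistent Q)
    (hsplit : ∀ Q, P Q → ∃ (φ : Fin n → PartitionedFormula L U α) (_ : ∀ i, φ i ∈ Δ)
      (c : ∀ i, Fin (φ i).1 → U), ∀ σ : Fin n → Bool,
        P (Q ∪ {Formula.iInf (fun i => signed ((φ i).inst (c i)) (σ i))}))
    {Q : PartialType L U α} (hQ : P Q) : OpRankInfinite n Δ Q := by
  intro γ
  induction γ using Ordinal.limitRecOn generalizing Q with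
  | zero => exact OpRankGE.zero Q (hP Q hQ)
  | add_one γ ih =>
    rw [← Order.succ_eq_add_one]
    obtain ⟨φ, hφ, c, hc⟩ := hsplit Q hQ
    exact OpRankGE.succ γ Q φ hφ c fun σ => ih (hc σ)
  | limit γ hγ ih => exact OpRankGE.limit γ Q hγ fun δ hδ => ih δ hδ hQ

/-- On some interval of `ℚ`, every cut of the sequence `R` by `D` is realized in `Q`. -/
def RealizesCuts {Y : Type} (D : Set (α ⊕ Y → U)) (R : ℚ → Y → U) (Q : PartialType L U α) : Prop :=
  ∃ q r : ℚ, 0 ≤ q ∧ q < r ∧ r ≤ 1 ∧ ∀ z, q < z → z < r →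
    ∀ F : Finset ℚ, (∀ t ∈ F, 0 ≤ t ∧ t < 1 ∧ t ≠ z) →
      ∀ s : Finset (L[[U]].Formula α), (s : Set (L[[U]].Formula α)) ⊆ Q →
        ∃ c' : α → U, (∀ φ ∈ s, φ.Realize c') ∧ ∀ t ∈ F, (Sum.elim c' (R t) ∈ D ↔ z < t)

theorem RealizesCuts.consistent {Y : Type} {D : Set (α ⊕ Y → U)} {R : ℚ → Y → U}
    {Q : PartialType L U α} (h : RealizesCuts D R Q) : Consistent Q := by
  obtain ⟨q, r, -, hqr, -, h⟩ := h
  obtain ⟨z, hz, hz'⟩ := exists_between hqr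
  intro s hs
  obtain ⟨c', hc', -⟩ := h z hz hz' ∅ (by simp) s hs
  exact ⟨c', hc'⟩

theorem realizesCuts_tp {Y : Type} {c : α → U} {B : Set U} {D : Fin 1 → Set (α ⊕ Y → U)}
    (hD : ∀ i, B.Definable L (D i)) {R : ℚ → Y → U} (hR : Indisc L B R) (hcut : Cuts D c R) :
    RealizesCuts (D 0) R (tp L c B) := by
  refine ⟨0, 1, le_rfl, zero_lt_one, le_rfl, fun z hz hz' F hF s hs => ?_⟩
  obtain ⟨C, hC, hcC, hCs⟩ := exists_definable_of_subset_tp hs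
  let P : F → Set (α ⊕ (ℚ × Y) → U) := fun t => (fun z => z ∘ Sum.map id (Prod.mk t.1)) ⁻¹' D 0
  have hPmem : ∀ (t : F) (c' : α → U) (g : ℚ × Y → U), Sum.elim c' g ∈ P t ↔
      Sum.elim c' (fun y => g (t.1, y)) ∈ D 0 := fun t c' g => by
    have : (Sum.elim c' g ∘ Sum.map id (Prod.mk t.1) : α ⊕ Y → U) =
        Sum.elim c' (fun y => g (t.1, y)) := by ext (l | l) <;> rfl
    simp only [P, mem_preimage, this]
  -- Rows above `z` are moved past the point 1, where `c` cuts the sequence.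
  let h : ℚ → ℚ := fun t => if z < t then t + 1 else t
  have hh : StrictMonoOn h F := fun t _ t' _ htt => by
    simp only [h]
    split_ifs <;> linarith
  have hE := definable_exists_pattern hC (P := P) (fun t => (hD 0).preimage_comp _)
    (fun t => z < t.1)
  obtain ⟨c', hc', hp⟩ := (hR.mem_iff hE (S := F) (h := h) (fun w w' hww => by
      rintro ⟨c', hc', hp⟩
      refine ⟨c', hc', fun t => ?_⟩
      rw [← hp t, hPmem, hPmem]
      simp only [hww t.1 t.2]) hh).2 ⟨c, hcC, fun t => by
      obtain ⟨h0, h1, hne⟩ := hF t.1 t.2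
      rw [hPmem]
      simp only [h]
      split_ifs with hzt
      · refine ⟨fun _ => hzt, fun _ => (hcut 0 _).2 (Int.floor_eq_iff.2 ⟨?_, ?_⟩)⟩ <;>
          simp <;> linarith
      · refine ⟨fun hm => absurd hm ((hcut 0 _).1 (Int.floor_eq_iff.2 ⟨?_, ?_⟩)),
          fun hzt' => absurd hzt' hzt⟩ <;> simp <;> linarith⟩
  exact ⟨c', hCs c' hc', fun t ht => (hPmem ⟨t, ht⟩ c' _).symm.trans (hp ⟨t, ht⟩)⟩

/-- Finitely many formulas that code, for a cut by `D` of a sequence of `2 ^ n + 1` rows, the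
position of the cut by `n` truth values. -/
theorem exists_coding_formulas {Y : Type} [Finite Y] {B : Set U} {D : Set (α ⊕ Y → U)}
    (hD : B.Definable L D) (n : ℕ) :
    ∃ (N : ℕ) (e : (Fin n → Bool) → Fin N) (φ : Fin n → PartitionedFormula L U α),
      ∀ R : Fin (N + 1) → Y → U, ∃ d : ∀ i, Fin (φ i).1 → U,
        ∀ (c' : α → U) (σ : Fin n → Bool),
          (∀ t : Fin (N + 1), Sum.elim c' (R t) ∈ D ↔ (e σ).castSucc < t) →
            ∀ i, ((φ i).inst (d i)).Realize c' ↔ σ i = true := by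
  classical
  let N := Fintype.card (Fin n → Bool)
  let e : (Fin n → Bool) ≃ Fin N := Fintype.equivFin _
  obtain ⟨k, ⟨eW⟩⟩ := Finite.exists_equiv_fin (Fin (N + 1) × Y)
  let row : Fin (N + 1) → Set (α ⊕ Fin k → U) := fun t =>
    (fun z => z ∘ Sum.map id (fun y => eW (t, y))) ⁻¹' D
  -- The `i`-th formula says that the cut lies in one of the gaps whose code has `i`-th digit true.
  have hΦ : ∀ i : Fin n, B.Definable L
      (⋃ σ : {σ : Fin n → Bool // σ i = true}, (row (e σ).castSucc)ᶜ ∩ row (e σ).succ) := fun i =>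
    definable_iUnion_of_finite fun σ => (hD.preimage_comp _).compl.inter (hD.preimage_comp _)
  choose φ hφ hφΦ using fun i => exists_mem_formulasOver (hΦ i)
  refine ⟨N, e, fun i => ⟨k, φ i⟩, fun R => ⟨fun i m => R (eW.symm m).1 (eW.symm m).2,
    fun c' σ hσ i => ?_⟩⟩
  rw [PartitionedFormula.realize_inst, hφΦ, mem_iUnion]
  have hrow : ∀ t, Sum.elim c' (fun m => R (eW.symm m).1 (eW.symm m).2) ∈ row t ↔
      (e σ).castSucc < t := fun t => by
    rw [← hσ t, mem_preimage]
    apply iff_of_eq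
    congr 1
    ext (l | l) <;> simp
  simp only [mem_inter_iff, mem_compl_iff, hrow, Fin.castSucc_lt_castSucc_iff, not_lt,
    Fin.castSucc_lt_succ_iff]
  constructor
  · rintro ⟨τ, h1, h2⟩
    rw [e.injective (le_antisymm h2 h1)]
    exact τ.2
  · exact fun h => ⟨⟨σ, h⟩, le_rfl, le_rfl⟩

/-- Place `N + 1` rows in the interval. Below the branch σ, restrict to the gap coded by σ: every
cut there has code σ, so its realizations satisfy the added formula automatically. -/
theorem RealizesCuts.split {Y : Type} {D : Set (α ⊕ Y → U)} {R : ℚ → Y → U}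
    {Q : PartialType L U α} (h : RealizesCuts D R Q) {n N : ℕ} {e : (Fin n → Bool) → Fin N}
    {φ : Fin n → PartitionedFormula L U α}
    (hφ : ∀ R : Fin (N + 1) → Y → U, ∃ d : ∀ i, Fin (φ i).1 → U,
        ∀ (c' : α → U) (σ : Fin n → Bool),
          (∀ t : Fin (N + 1), Sum.elim c' (R t) ∈ D ↔ (e σ).castSucc < t) →
            ∀ i, ((φ i).inst (d i)).Realize c' ↔ σ i = true) :
    ∃ d : ∀ i, Fin (φ i).1 → U, ∀ σ : Fin n → Bool,
      RealizesCuts D R (Q ∪ {Formula.iInf (fun i => signed ((φ i).inst (d i)) (σ i))}) := by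
  classical
  obtain ⟨q, r, hq, hqr, hr, h⟩ := h
  let pt : ℕ → ℚ := fun t => q + (r - q) * blockPoint 0 (t + 1)
  have hpt : StrictMono pt := fun t t' htt => by
    have := mul_lt_mul_of_pos_left (blockPoint_strictMono 0 (Nat.succ_lt_succ htt))
      (sub_pos.2 hqr)
    simp only [pt]
    linarith
  have hptq : ∀ t, q < pt t := fun t => by
    have h1 : (0 : ℚ) < blockPoint 0 (t + 1) :=
      lt_of_le_of_lt (by simpa using le_blockPoint 0 0) (blockPoint_strictMono 0 (Nat.succ_pos t))
    have := mul_pos (sub_pos.2 hqr) h1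
    simp only [pt]
    linarith
  have hptr : ∀ t, pt t < r := fun t => by
    have h1 : blockPoint 0 (t + 1) < 1 := by simpa using blockPoint_lt 0 (t + 1)
    have := mul_lt_mul_of_pos_left h1 (sub_pos.2 hqr)
    simp only [pt]
    linarith
  obtain ⟨d, hd⟩ := hφ fun t => R (pt t)
  refine ⟨d, fun σ => ⟨pt (e σ), pt (e σ + 1), hq.trans (hptq _).le, hpt (Nat.lt_succ_self _),
    (hptr _).le.trans hr, fun z hz hz' F hF s hs => ?_⟩⟩
  have hzt : ∀ t : Fin (N + 1), z < pt t ↔ (e σ).castSucc < t := fun t => by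
    rw [Fin.lt_def, Fin.val_castSucc]
    constructor
    · exact fun h => hpt.lt_iff_lt.1 (hz.trans h)
    · exact fun h => hz'.trans_le (hpt.monotone h)
  obtain ⟨c', hc', hc'F⟩ := h z ((hptq _).trans hz) (hz'.trans (hptr _))
    (F ∪ Finset.univ.image fun t : Fin (N + 1) => pt t) (fun t ht => by
      rcases Finset.mem_union.1 ht with ht | ht
      · exact hF t ht
      · obtain ⟨t, -, rfl⟩ := Finset.mem_image.1 ht
        refine ⟨hq.trans (hptq _).le, (hptr _).trans_le hr, fun heq => ?_⟩
        rw [← heq] at hz hz'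
        have h1 := hpt.lt_iff_lt.1 hz
        have h2 := hpt.lt_iff_lt.1 hz'
        omega)
    (s.filter (· ∈ Q)) (fun χ hχ => (Finset.mem_filter.1 hχ).2)
  refine ⟨c', fun χ hχ => ?_, fun t ht => hc'F t (Finset.mem_union_left _ ht)⟩
  rcases hs hχ with hχ' | hχ'
  · exact hc' χ (Finset.mem_filter.2 ⟨hχ, hχ'⟩)
  · rw [mem_singleton_iff.1 hχ', Formula.realize_iInf]
    intro i
    rw [realize_signed]
    refine hd c' σ (fun t => ?_) i
    rw [← hzt t]
    exact hc'F _ (Finset.mem_union_right _ (Finset.mem_image_of_mem _ (Finset.mem_univ t)))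

theorem exists_opRankInfinite_of_one_mem [Finite α] {κ : Cardinal.{w}} (hκ : ℵ₀ ≤ κ)
    (hU : IsSaturated L U κ) {B : Set U} (hB : #B < κ) {c : α → U}
    (h : 1 ∈ irdDepths (tp L c B)) (n : ℕ) :
    ∃ Δ : Finset (PartitionedFormula L U α), OpRankInfinite n Δ (tp L c B) := by
  classical
  obtain ⟨Y, _, D, R, hD, hR⟩ := exists_rows_of_mem_irdDepths h
  have hDB : ∀ i, B.Definable L (D i) := fun i => (hD i).mono (empty_subset _)
  obtain ⟨R, hR, hcut⟩ := exists_indisc_cuts hκ hU hB c hDB R hR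
  obtain ⟨N, e, φ, hφ⟩ := exists_coding_formulas (hDB 0) n
  refine ⟨Finset.univ.image φ, opRankInfinite_of_split (RealizesCuts (D 0) R)
    (fun Q hQ => hQ.consistent) (fun Q hQ => ?_) (realizesCuts_tp hDB hR hcut)⟩
  obtain ⟨d, hd⟩ := hQ.split hφ
  exact ⟨φ, fun i => Finset.mem_image_of_mem _ (Finset.mem_univ i), d, hd⟩

end OpRankOfPattern

/-! ### Binary trees of splittings and half graphs. -/

section BinaryTrees

variable {X : Type*}

/-- Every set in `𝓑` is nonempty, and is split by some `S ∈ 𝓕` so that both sides contain a set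
in `𝓑`. -/
def SplitClosed (𝓕 𝓑 : Set (Set X)) : Prop :=
  ∀ Z ∈ 𝓑, Z.Nonempty ∧ ∃ S ∈ 𝓕, (∃ Z₁ ∈ 𝓑, Z₁ ⊆ Z ∩ S) ∧ ∃ Z₀ ∈ 𝓑, Z₀ ⊆ Z \ S

/-- `Z` carries a complete binary tree of splittings by sets in `𝓕`. -/
def Splits (𝓕 : Set (Set X)) (Z : Set X) : Prop :=
  ∃ 𝓑, SplitClosed 𝓕 𝓑 ∧ ∃ W ∈ 𝓑, W ⊆ Z

theorem Splits.mono {𝓕 : Set (Set X)} {Z Z' : Set X} (h : Splits 𝓕 Z) (hZ : Z ⊆ Z') :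
    Splits 𝓕 Z' := by
  obtain ⟨𝓑, h𝓑, W, hW, hWZ⟩ := h
  exact ⟨𝓑, h𝓑, W, hW, hWZ.trans hZ⟩

theorem Splits.nonempty {𝓕 : Set (Set X)} {Z : Set X} (h : Splits 𝓕 Z) : Z.Nonempty := by
  obtain ⟨𝓑, h𝓑, W, hW, hWZ⟩ := h
  exact (h𝓑 W hW).1.mono hWZ

theorem Splits.exists_split {𝓕 : Set (Set X)} {Z : Set X} (h : Splits 𝓕 Z) :
    ∃ S ∈ 𝓕, Splits 𝓕 (Z ∩ S) ∧ Splits 𝓕 (Z \ S) := by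
  obtain ⟨𝓑, h𝓑, W, hW, hWZ⟩ := h
  obtain ⟨-, S, hS, ⟨Z₁, hZ₁, h₁⟩, Z₀, hZ₀, h₀⟩ := h𝓑 W hW
  exact ⟨S, hS, ⟨𝓑, h𝓑, Z₁, hZ₁, h₁.trans (inter_subset_inter_left _ hWZ)⟩,
    ⟨𝓑, h𝓑, Z₀, hZ₀, h₀.trans (sdiff_subset_sdiff_left hWZ)⟩⟩

/-- Either below every member of the family under `W` some member is split by `𝓕₁`, and that
splitting also splits the larger set; or below some `V` no member is, and all splittings there come
from `𝓕₂`. -/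
theorem Splits.of_union {𝓕₁ 𝓕₂ : Set (Set X)} {Z : Set X} (h : Splits (𝓕₁ ∪ 𝓕₂) Z) :
    Splits 𝓕₁ Z ∨ Splits 𝓕₂ Z := by
  obtain ⟨𝓑, h𝓑, W, hW, hWZ⟩ := h
  by_cases hA : ∀ V ∈ 𝓑, V ⊆ W → ∃ V' ∈ 𝓑, V' ⊆ V ∧
      ∃ S ∈ 𝓕₁, (∃ Z₁ ∈ 𝓑, Z₁ ⊆ V' ∩ S) ∧ ∃ Z₀ ∈ 𝓑, Z₀ ⊆ V' \ S
  · refine Or.inl ⟨{V | V ∈ 𝓑 ∧ V ⊆ W}, fun V hV => ⟨(h𝓑 V hV.1).1, ?_⟩, W, ⟨hW, subset_rfl⟩, hWZ⟩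
    obtain ⟨V', -, hVV, S, hS, ⟨Z₁, hZ₁, h₁⟩, Z₀, hZ₀, h₀⟩ := hA V hV.1 hV.2
    have h₁' : Z₁ ⊆ V ∩ S := h₁.trans (inter_subset_inter_left _ hVV)
    have h₀' : Z₀ ⊆ V \ S := h₀.trans (sdiff_subset_sdiff_left hVV)
    exact ⟨S, hS, ⟨Z₁, ⟨hZ₁, (h₁'.trans inter_subset_left).trans hV.2⟩, h₁'⟩,
      Z₀, ⟨hZ₀, (h₀'.trans sdiff_subset).trans hV.2⟩, h₀'⟩
  · push Not at hA
    obtain ⟨V, hV, hVW, hA⟩ := hA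
    refine Or.inr ⟨{V' | V' ∈ 𝓑 ∧ V' ⊆ V}, fun V' hV' => ⟨(h𝓑 V' hV'.1).1, ?_⟩,
      V, ⟨hV, subset_rfl⟩, hVW.trans hWZ⟩
    obtain ⟨-, S, hS, ⟨Z₁, hZ₁, h₁⟩, Z₀, hZ₀, h₀⟩ := h𝓑 V' hV'.1
    have hS₂ : S ∈ 𝓕₂ := hS.resolve_left fun hS₁ =>
      hA V' hV'.1 hV'.2 S hS₁ ⟨Z₁, hZ₁, h₁⟩ Z₀ hZ₀ h₀
    exact ⟨S, hS₂, ⟨Z₁, ⟨hZ₁, (h₁.trans inter_subset_left).trans hV'.2⟩, h₁⟩,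
      Z₀, ⟨hZ₀, (h₀.trans sdiff_subset).trans hV'.2⟩, h₀⟩

theorem Splits.of_biUnion {K : Type*} {t : Finset K} {𝓕 : K → Set (Set X)} {Z : Set X}
    (h : Splits (⋃ k ∈ t, 𝓕 k) Z) : ∃ k ∈ t, Splits (𝓕 k) Z := by
  classical
  induction t using Finset.induction_on with
  | empty =>
    obtain ⟨S, hS, -⟩ := h.exists_split
    simp at hS
  | insert k t _ ih =>
    rw [Finset.set_biUnion_insert] at h
    rcases h.of_union with h | h
    · exact ⟨k, Finset.mem_insert_self _ _, h⟩
    · obtain ⟨k', hk', h⟩ := ih h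
      exact ⟨k', Finset.mem_insert_of_mem hk', h⟩

/-- Fix a point `x` and sort `𝓕` by whether its sets contain `x`. One of the two classes still
splits `Z`; split by a set `S` in it and continue on the side of `S` away from `x`. -/
theorem Splits.exists_step {𝓕 : Set (Set X)} {Z : Set X} (h : Splits 𝓕 Z) :
    ∃ x ∈ Z, ∃ S ∈ 𝓕, ∃ 𝓕' ⊆ 𝓕, ∃ Z' ⊆ Z, Splits 𝓕' Z' ∧
      ((x ∈ S ∧ (∀ S' ∈ 𝓕', x ∈ S') ∧ ∀ x' ∈ Z', x' ∉ S) ∨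
        (x ∉ S ∧ (∀ S' ∈ 𝓕', x ∉ S') ∧ ∀ x' ∈ Z', x' ∈ S)) := by
  obtain ⟨x, hx⟩ := h.nonempty
  have h𝓕 : {S | S ∈ 𝓕 ∧ x ∈ S} ∪ {S | S ∈ 𝓕 ∧ x ∉ S} = 𝓕 := by
    ext S
    simp only [mem_union, mem_ofPred_eq]
    tauto
  rw [← h𝓕] at h
  rcases h.of_union with h | h
  · obtain ⟨S, hS, -, h₀⟩ := h.exists_split
    exact ⟨x, hx, S, hS.1, _, fun S' hS' => hS'.1, _, sdiff_subset, h₀,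
      Or.inl ⟨hS.2, fun S' hS' => hS'.2, fun x' hx' => hx'.2⟩⟩
  · obtain ⟨S, hS, h₁, -⟩ := h.exists_split
    exact ⟨x, hx, S, hS.1, _, fun S' hS' => hS'.1, _, inter_subset_left, h₁,
      Or.inr ⟨hS.2, fun S' hS' => hS'.2, fun x' hx' => hx'.2⟩⟩

/-- A complete binary tree of splittings yields an infinite half graph. -/
theorem Splits.exists_ladder {𝓕 : Set (Set X)} {Z : Set X} (h : Splits 𝓕 Z) :
    ∃ (x : ℕ → X) (S : ℕ → Set X), (∀ t, x t ∈ Z) ∧ (∀ t, S t ∈ 𝓕) ∧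
      ((∀ t t', x t ∈ S t' ↔ t ≤ t') ∨ ∀ t t', x t ∈ S t' ↔ t' < t) := by
  choose x hx S hS 𝓕' h𝓕' Z' hZ' hsplit hcol using
    fun p : {p : Set (Set X) × Set X // Splits p.1 p.2} => p.2.exists_step
  let g : ℕ → {p : Set (Set X) × Set X // Splits p.1 p.2} := fun t =>
    Nat.rec ⟨(𝓕, Z), h⟩ (fun _ p => ⟨(𝓕' p, Z' p), hsplit p⟩) t
  have hg : ∀ t d, (g (t + d)).1.1 ⊆ (g t).1.1 ∧ (g (t + d)).1.2 ⊆ (g t).1.2 := by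
    intro t d
    induction d with
    | zero => exact ⟨subset_rfl, subset_rfl⟩
    | succ d ih => exact ⟨(h𝓕' (g (t + d))).trans ih.1, (hZ' (g (t + d))).trans ih.2⟩
  have hlt : ∀ t t', t < t' → S (g t') ∈ 𝓕' (g t) ∧ x (g t') ∈ Z' (g t) := fun t t' htt => by
    obtain ⟨d, rfl⟩ := Nat.exists_eq_add_of_le (Nat.succ_le_of_lt htt)
    exact ⟨(hg (t + 1) d).1 (hS _), (hg (t + 1) d).2 (hx _)⟩
  have h0 : ∀ t, S (g t) ∈ 𝓕 ∧ x (g t) ∈ Z := fun t => by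
    have := hg 0 t
    rw [Nat.zero_add] at this
    exact ⟨this.1 (hS _), this.2 (hx _)⟩
  -- For `t < t'` both memberships between the steps `t` and `t'` are decided by `V t`. A
  -- subsequence with constant `V` is a half graph, whose orientation depends on that constant.
  let V : ℕ → Prop := fun t => x (g t) ∈ S (g t)
  have hV : ∀ t, V t → ∀ t', t < t' → x (g t) ∈ S (g t') ∧ x (g t') ∉ S (g t) :=
    fun t ht t' htt => by
      rcases hcol (g t) with hc | hc
      · exact ⟨hc.2.1 _ (hlt t t' htt).1, hc.2.2 _ (hlt t t' htt).2⟩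
      · exact absurd ht hc.1
  have hV' : ∀ t, ¬ V t → ∀ t', t < t' → x (g t) ∉ S (g t') ∧ x (g t') ∈ S (g t) :=
    fun t ht t' htt => by
      rcases hcol (g t) with hc | hc
      · exact absurd hc.1 ht
      · exact ⟨hc.2.1 _ (hlt t t' htt).1, hc.2.2 _ (hlt t t' htt).2⟩
  by_cases hf : ∃ᶠ t in Filter.atTop, V t
  · obtain ⟨p, hp, hpV⟩ := Filter.extraction_of_frequently_atTop hf
    refine ⟨fun t => x (g (p t)), fun t => S (g (p t)), fun t => (h0 _).2, fun t => (h0 _).1,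
      Or.inl fun t t' => ?_⟩
    rcases lt_trichotomy t t' with htt | rfl | htt
    · exact iff_of_true (hV _ (hpV t) _ (hp htt)).1 htt.le
    · exact iff_of_true (hpV t) le_rfl
    · exact iff_of_false (hV _ (hpV t') _ (hp htt)).2 (not_le.2 htt)
  · rw [Filter.not_frequently, Filter.eventually_atTop] at hf
    obtain ⟨N, hN⟩ := hf
    have hN' : ∀ t, ¬ V (N + t) := fun t => hN _ (Nat.le_add_right _ _)
    refine ⟨fun t => x (g (N + t)), fun t => S (g (N + t)), fun t => (h0 _).2,
      fun t => (h0 _).1, Or.inr fun t t' => ?_⟩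
    rcases lt_trichotomy t t' with htt | rfl | htt
    · exact iff_of_false (hV' _ (hN' t) _ (Nat.add_lt_add_left htt N)).1 (not_lt.2 htt.le)
    · exact iff_of_false (hN' t) (lt_irrefl _)
    · exact iff_of_true (hV' _ (hN' t') _ (Nat.add_lt_add_left htt N)).2 htt

end BinaryTrees

/-! ### From infinite op-rank to a pattern of depth 1. -/

section PatternOfOpRank

variable {L : FirstOrder.Language.{u, v}} {U : Type w} [L.Structure U] {α : Type x}
  {n : ℕ} {Δ : Finset (PartitionedFormula L U α)}

theorem Consistent.mono {Q Q' : PartialType L U α} (h : Consistent Q') (hQ : Q ⊆ Q') :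
    Consistent Q := fun s hs => h s (hs.trans hQ)

theorem OpRankGE.mono {γ : Ordinal.{w}} {Q Q' : PartialType L U α} (h : OpRankGE n Δ γ Q')
    (hQ : Q ⊆ Q') : OpRankGE n Δ γ Q := by
  induction h generalizing Q with
  | zero Q' h => exact OpRankGE.zero Q (h.mono hQ)
  | limit γ Q' hγ _ ih => exact OpRankGE.limit γ Q hγ fun δ hδ => ih δ hδ hQ
  | succ γ Q' φ hφ c _ ih =>
    exact OpRankGE.succ γ Q φ hφ c fun σ => ih σ (union_subset_union_left _ hQ)

theorem OpRankGE.of_le {γ δ : Ordinal.{w}} {Q : PartialType L U α} (h : OpRankGE n Δ γ Q)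
    (hδ : δ ≤ γ) : OpRankGE n Δ δ Q := by
  induction h generalizing δ with
  | zero Q h =>
    rw [nonpos_iff_eq_zero.1 hδ]
    exact OpRankGE.zero Q h
  | limit γ Q hγ h ih =>
    rcases hδ.eq_or_lt with rfl | hδ
    · exact OpRankGE.limit _ Q hγ h
    · exact h δ hδ
  | succ γ Q φ hφ c h ih =>
    rcases hδ.eq_or_lt with rfl | hδ
    · exact OpRankGE.succ γ Q φ hφ c h
    · exact (ih (fun _ => true) (Order.lt_succ_iff.1 hδ)).mono subset_union_left

theorem OpRankGE.consistent {γ : Ordinal.{w}} {Q : PartialType L U α} (h : OpRankGE n Δ γ Q) :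
    Consistent Q := by
  induction h with
  | zero Q h => exact h
  | limit γ Q hγ _ ih => exact ih 0 hγ.bot_lt
  | succ γ Q φ hφ c _ ih => exact (ih fun _ => true).mono subset_union_left

theorem OpRankGE.exists_of_succ {γ : Ordinal.{w}} {Q : PartialType L U α}
    (h : OpRankGE n Δ (Order.succ γ) Q) :
    ∃ (φ : Fin n → PartitionedFormula L U α) (_ : ∀ i, φ i ∈ Δ) (c : ∀ i, Fin (φ i).1 → U),
      ∀ σ : Fin n → Bool,
        OpRankGE n Δ γ (Q ∪ {Formula.iInf (fun i => signed ((φ i).inst (c i)) (σ i))}) := by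
  generalize hδ : Order.succ γ = δ at h
  cases h with
  | zero h => exact absurd hδ (Order.succ_ne_bot γ)
  | limit _ _ hγ' _ => exact absurd (hδ ▸ hγ') (Order.not_isSuccLimit_succ γ)
  | succ γ' _ φ hφ c h =>
    rw [Order.succ_injective hδ]
    exact ⟨φ, hφ, c, h⟩

/-- If every choice of instances failed at some ordinal, the rank could not exceed the supremum of
these ordinals, which exists because the choices form a small family. -/
theorem OpRankInfinite.exists_split {Q : PartialType L U α} (h : OpRankInfinite n Δ Q) :
    ∃ (φ : Fin n → PartitionedFormula L U α) (_ : ∀ i, φ i ∈ Δ) (c : ∀ i, Fin (φ i).1 → U),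
      ∀ σ : Fin n → Bool,
        OpRankInfinite n Δ (Q ∪ {Formula.iInf (fun i => signed ((φ i).inst (c i)) (σ i))}) := by
  by_contra hne
  have hne' : ∀ k : (Σ φ : Fin n → Δ, ∀ i, Fin (φ i).1.1 → U), ∃ (σ : Fin n → Bool)
      (γ : Ordinal.{w}), ¬ OpRankGE n Δ γ
        (Q ∪ {Formula.iInf (fun i => signed ((k.1 i).1.inst (k.2 i)) (σ i))}) := by
    intro k
    by_contra hk
    push Not at hk
    exact hne ⟨fun i => (k.1 i).1, fun i => (k.1 i).2, k.2, hk⟩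
  choose σ γ hγ using hne'
  obtain ⟨φ, hφ, c, hc⟩ := (h (Order.succ (⨆ k, γ k))).exists_of_succ
  exact hγ ⟨fun i => ⟨φ i, hφ i⟩, c⟩ ((hc _).of_le (Ordinal.le_iSup γ ⟨fun i => ⟨φ i, hφ i⟩, c⟩))

/-- Finitely many extra formulas bring finitely many new parameters, so the parameter set stays
below κ. -/
theorem IsSaturated.exists_realize [Countable α] {κ : Cardinal.{w}} (hκ : ℵ₀ ≤ κ)
    (hU : IsSaturated L U κ) {B : Set U} (hB : #B < κ) {c : α → U}
    {s : Finset (L[[U]].Formula α)} (h : Consistent (tp L c B ∪ s)) :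
    ∃ c' : α → U, ∀ φ ∈ tp L c B ∪ s, φ.Realize c' := by
  classical
  choose p e G hG hGe using fun φ : s =>
    exists_empty_definable_fiber (definable_univ_of_formula φ.1)
  let e' : (Σ φ : s, Fin (p φ)) → U := fun k => e k.1 k.2
  have hdef : ∀ φ : (tp L c B ∪ s : Set (L[[U]].Formula α)),
      (B ∪ range e').Definable L {z | φ.1.Realize z} := by
    rintro ⟨φ, hφ | hφ⟩
    · exact (definable_of_mem_formulasOver hφ.1).mono subset_union_left
    · have h1 := definable_fiber (e ⟨φ, hφ⟩) (hG ⟨φ, hφ⟩)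
      convert h1.mono (B := B ∪ range e') ?_ using 1
      · ext z
        exact hGe ⟨φ, hφ⟩ z
      · rw [empty_union]
        rintro _ ⟨i, rfl⟩
        exact Or.inr ⟨⟨⟨φ, hφ⟩, i⟩, rfl⟩
  obtain ⟨c', hc'⟩ := hU.exists_countable hκ (mk_union_range_lt hκ hB e') hdef (fun t => by
    obtain ⟨c', hc'⟩ := h (t.image Subtype.val) (by
      intro φ hφ
      obtain ⟨ψ, -, rfl⟩ := Finset.mem_image.1 hφ
      exact ψ.2)
    exact ⟨c', fun φ hφ => hc' φ.1 (Finset.mem_image_of_mem _ hφ)⟩)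
  exact ⟨c', fun φ hφ => hc' ⟨φ, hφ⟩⟩

/-- One of the `n` instances per step suffices for a binary tree. The tree can be taken with a
single formula of `Δ`, and its half graph consists of realizations of `tp(c/B)`. -/
theorem one_mem_irdDepths_of_opRankInfinite [Countable α] {κ : Cardinal.{w}} (hκ : ℵ₀ ≤ κ)
    (hU : IsSaturated L U κ) {B : Set U} (hB : #B < κ) {c : α → U} (hn : 0 < n)
    (h : OpRankInfinite n Δ (tp L c B)) : 1 ∈ irdDepths (tp L c B) := by
  classical
  let sol : PartialType L U α → Set (α → U) := fun Q => {z | ∀ φ ∈ Q, φ.Realize z}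
  let 𝓕 : PartitionedFormula L U α → Set (Set (α → U)) := fun φ =>
    range fun d : Fin φ.1 → U => {z | (φ.inst d).Realize z}
  have hsplit : Splits (⋃ φ ∈ Δ, 𝓕 φ) (sol (tp L c B)) := by
    refine ⟨{Z | ∃ s : Finset (L[[U]].Formula α), OpRankInfinite n Δ (tp L c B ∪ s) ∧
      Z = sol (tp L c B ∪ s)}, ?_, sol (tp L c B), ⟨∅, by simpa using h, by simp⟩, subset_rfl⟩
    rintro _ ⟨s, hs, rfl⟩
    refine ⟨hU.exists_realize hκ hB (hs 0).consistent, ?_⟩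
    obtain ⟨φ, hφ, d, hd⟩ := hs.exists_split
    have hmem : ∀ (σ : Fin n → Bool), sol (tp L c B ∪ (insert
        (Formula.iInf (fun i => signed ((φ i).inst (d i)) (σ i))) s : Finset _)) ⊆
        sol (tp L c B ∪ s) ∩ {z | ((φ ⟨0, hn⟩).inst (d ⟨0, hn⟩)).Realize z ↔ σ ⟨0, hn⟩ = true} := by
      intro σ z hz
      refine ⟨fun χ hχ => hz χ (hχ.imp_right fun h => by simp [Finset.mem_coe.1 h]), ?_⟩
      have := hz (Formula.iInf (fun i => signed ((φ i).inst (d i)) (σ i))) (Or.inr (by simp))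
      rw [Formula.realize_iInf] at this
      exact (realize_signed _ _ _).1 (this ⟨0, hn⟩)
    have hrank : ∀ (σ : Fin n → Bool), OpRankInfinite n Δ (tp L c B ∪ (insert
        (Formula.iInf (fun i => signed ((φ i).inst (d i)) (σ i))) s : Finset _)) := by
      intro σ
      rw [Finset.coe_insert, insert_eq, union_comm {_}, ← union_assoc]
      exact hd σ
    refine ⟨_, mem_biUnion (hφ ⟨0, hn⟩) ⟨d ⟨0, hn⟩, rfl⟩,
      ⟨_, ⟨_, hrank fun _ => true, rfl⟩, fun z hz => ?_⟩,
      ⟨_, ⟨_, hrank fun _ => false, rfl⟩, fun z hz => ?_⟩⟩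
    · have := hmem (fun _ => true) hz
      exact ⟨this.1, this.2.2 rfl⟩
    · have := hmem (fun _ => false) hz
      exact ⟨this.1, fun h => Bool.false_ne_true (this.2.1 h)⟩
  obtain ⟨φ, -, hφ⟩ := hsplit.of_biUnion
  obtain ⟨a, S, ha, hS, hladder⟩ := hφ.exists_ladder
  choose d hd using hS
  have hSmem : ∀ t z, z ∈ S t ↔ Sum.elim z (d t) ∈ {z | φ.2.Realize z} := fun t z => by
    rw [← hd t]
    exact φ.realize_inst (d t) z
  have hmem : ∀ C : Set (α → U), B.Definable L C → c ∈ C → ∀ t, a t ∈ C := fun C hC hc t => by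
    obtain ⟨χ, hχ, hχC⟩ := exists_mem_formulasOver hC
    exact (hχC _).1 (ha t χ ⟨hχ, (hχC _).2 hc⟩)
  rcases hladder with hl | hl
  · refine Fintype.card_unique (α := Fin 1) ▸ card_mem_irdDepths (I := Fin 1)
      (D := fun _ => {z | φ.2.Realize z}) (fun _ => definable_univ_of_formula φ.2) (fun _ => d)
      fun C hC hc f N => ⟨a (f 0), hmem C hC hc _, fun i j _ => ?_⟩
    rw [← hSmem, hl, Subsingleton.elim i 0]
  -- The half graph has the opposite orientation, so the formula is negated.
  · refine Fintype.card_unique (α := Fin 1) ▸ card_mem_irdDepths (I := Fin 1)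
      (D := fun _ => {z | φ.2.Realize z}ᶜ) (fun _ => (definable_univ_of_formula φ.2).compl)
      (fun _ => d) fun C hC hc f N => ⟨a (f 0), hmem C hC hc _, fun i j _ => ?_⟩
    rw [mem_compl_iff, ← hSmem, hl, Subsingleton.elim i 0, not_lt]

theorem le_opDim {π : PartialType L U α} (hn : 0 < n)
    (h : ∃ Δ : Finset (PartitionedFormula L U α), OpRankInfinite n Δ π) : (n : ℕ∞) ≤ opDim π :=
  le_sSup ⟨n, ⟨hn, h⟩, rfl⟩

theorem le_irdDim {π : PartialType L U α} (h : n ∈ irdDepths π) : (n : ℕ∞) ≤ irdDim π :=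
  le_sSup ⟨n, h, rfl⟩

end PatternOfOpRank

end OpDimension

/-! ### Sub-additivity of both dimensions. -/

theorem mainTheorem1 {L : FirstOrder.Language.{u, v}} {U : Type w} [L.Structure U]
    {κ : Cardinal.{w}} (hκ : ℵ₀ < κ) (hU : OpDimension.IsSaturated L U κ)
    {m k : ℕ} (a : Fin m → U) (b : Fin k → U) (A : Set U) (hA : #A < κ) :
    OpDimension.opDim (OpDimension.tp L (Sum.elim a b) A) ≤
        OpDimension.opDim (OpDimension.tp L a A) +
          OpDimension.opDim (OpDimension.tp L b (A ∪ Set.range a)) ∧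
      OpDimension.irdDim (OpDimension.tp L (Sum.elim a b) A) ≤
        OpDimension.irdDim (OpDimension.tp L a A) +
          OpDimension.irdDim (OpDimension.tp L b (A ∪ Set.range a)) := by
  have hAa := OpDimension.mk_union_range_lt hκ.le hA a
  constructor
  · refine sSup_le ?_
    rintro _ ⟨n, ⟨hn, Δ, hΔ⟩, rfl⟩
    obtain ⟨n₁, h₁, n₂, h₂, h12⟩ := OpDimension.exists_add_of_mem_irdDepths hκ.le hU hA a b
      (OpDimension.one_mem_irdDepths_of_opRankInfinite hκ.le hU hA hn hΔ)
    -- The pattern of depth 1 passes whole to `a` or to `b`, whose op-dimension is then at least `n`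
    -- whatever `n` is.
    have h : n₁ = 1 ∨ n₂ = 1 := by omega
    rcases h with rfl | rfl
    · exact (OpDimension.le_opDim hn
        (OpDimension.exists_opRankInfinite_of_one_mem hκ.le hU hA h₁ n)).trans le_self_add
    · exact (OpDimension.le_opDim hn
        (OpDimension.exists_opRankInfinite_of_one_mem hκ.le hU hAa h₂ n)).trans le_add_self
  · refine sSup_le ?_
    rintro _ ⟨n, hn, rfl⟩
    obtain ⟨n₁, h₁, n₂, h₂, rfl⟩ := OpDimension.exists_add_of_mem_irdDepths hκ.le hU hA a b hn
    push_cast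
    exact add_le_add (OpDimension.le_irdDim h₁) (OpDimension.le_irdDim h₂)
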